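/- Let $I=(a,b)$ with $a<b$, let $\kappa>0$, and let $D=\bigcap_{r=1}^R\{y\in\mathbb R^3: |y|_{D_r}\le 1\}$, where $|y|_{D_r}^2=y\cdot G_{D_r}y$ with symmetric positive semi-definite matrices $G_{D_r}\in\mathbb R^{3\times3}$. Put $V_D(y)=\sum_{r=1}^R\frac12(|y|_{D_r}-1)_+^2$. Let $L_{\rm bc}:H^2(I;\mathbb R^3)\to\mathbb R^\ell$ be bounded and linear, let $\ell_{\rm bc}\in\mathbb R^\ell$, and set \[\mathcal A=\{v\in H^2(I;\mathbb R^3): |v'|=1 \text{ a.e. in } I,\ L_{\rm bc}[v]=\ell_{\rm bc}\};\] $u\in\mathcal A\cap D$ means that $u\in\mathcal A$ and $u(x)\in D$ for all $x\in[a,b]$. Define $E_{\rm bend}:H^2(I;\mathbb R^3)\to\mathbb R\cup\{+\infty\}$ by $E_{\rm bend}[u]=\frac\kappa2\int_I|u''|^2\,dx$ if $u\in\mathcal A\cap D$, and $E_{\rm bend}[u]=+\infty$ otherwise. For a partition $\mathcal P$ of $I$ with nodes $a=x_0<x_1<\dots<x_N=b$ let $h=\max_i(x_{i+1}-x_i)$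 be its mesh size, let $V_h$ be the space of $C^1$ functions on $[a,b]$ that are polynomials of degree at most three on each $[x_i,x_{i+1}]$, and let $\mathcal I_{1,h}$ be the continuous piecewise linear nodal interpolation. Let \[\mathcal A_h=\{u_h\in V_h^3: |u_h'(x_i)|^2=1\ (i=0,\dots,N),\ L_{\rm bc}[u_h]=\ell_{\rm bc}\},\] and for $\varepsilon>0$ define $E_{h,\varepsilon}:H^2(I;\mathbb R^3)\to\mathbb R\cup\{+\infty\}$ by \[E_{h,\varepsilon}[u_h]=\frac\kappa2\int_I|u_h''|^2\,dx+\frac1{2\varepsilon}\int_I\mathcal I_{1,h}V_D(u_h)\,dx\quad\text{if }u_h\in\mathcal A_h,\] and $E_{h,\varepsilon}[u_h]=+\infty$ otherwise. (The energy and $\mathcal A_h$ depend on the whole partition; the index $h$ is the usual shorthand.) (i) Let $(\mathcal P_i,\varepsilon_i,u_i)_i$ be any sequence (or, more generally, any family indexed along a filter) of partitions with mesh sizes $h_i\to0$, parameters $\varepsilon_i\to0$ with $\varepsilon_i>0$, and curves $u_i\in H^2(I;\mathbb R^3)$ that converge weakly in $H^2(I;\mathbb R^3)$ to some $u$. Then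 $E_{\rm bend}[u]\le\liminf_i E_{h_i,\varepsilon_i}[u_i]$. In particular, if the right-hand side is finite, then $u\in\mathcal A\cap D$. (ii) Assume in addition that $L_{\rm bc}$ realizes boundary conditions, i.e. $L_{\rm bc}[v]$ depends only on $v(a),v'(a),v(b),v'(b)$. Let $u\in\mathcal A\cap D$ with $u\in H^3(I;\mathbb R^3)$. Then for every partition the cubic Hermite interpolant $u_h=\mathcal I_{3,h}u\in V_h^3$, with $u_h(x_i)=u(x_i)$ and $u_h'(x_i)=u'(x_i)$ for $i=0,\dots,N$, exists in $H^2(I;\mathbb R^3)$ and satisfies $u_h\in\mathcal A_h$ and $u_h(x_i)\in D$ for all $i$. Moreover $u_h\to u$ strongly in $H^2(I;\mathbb R^3)$ as $h\to0$ and $\lim_{(h,\varepsilon)\to0}E_{h,\varepsilon}[u_h]=E_{\rm bend}[u]$, where $h\to 0$ and $\varepsilon\to0^+$ independently of each other and both limits are uniform over all partitions of mesh size $h$. -/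

import Mathlib

open MeasureTheory Set Filter Topology
open scoped ContDiff

noncomputable section

namespace ConfinedRod

/-- The ambient Euclidean space `ℝ³`. -/
abbrev Vec3 : Type := EuclideanSpace ℝ (Fin 3)

/-- Lebesgue measure on the open interval `I = (a, b)`. -/
abbrev μI (a b : ℝ) : Measure ℝ := volume.restrict (Ioo a b)

/-! ### Sobolev spaces on an interval -/

/-- `g` is the weak derivative of `f` on `(a, b)`:
`∫ φ' f = - ∫ φ g` for all `φ ∈ C_c^∞((a, b))`. -/
def IsWeakDeriv (a b : ℝ) (f g : ℝ → Vec3) : Prop :=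
  ∀ φ : ℝ → ℝ, ContDiff ℝ ∞ φ → HasCompactSupport φ → tsupport φ ⊆ Ioo a b →
    ∫ x in Ioo a b, deriv φ x • f x = - ∫ x in Ioo a b, φ x • g x

/-- A bounded continuous factor keeps an `L²` function on a bounded interval integrable. -/
theorem integrable_smul_Lp {a b : ℝ} (f : Lp Vec3 2 (μI a b)) {φ : ℝ → ℝ}
    (hφ : Continuous φ) (hc : HasCompactSupport φ) :
    Integrable (fun x => φ x • f x) (μI a b) := by
  have hf : Integrable f (μI a b) := (Lp.memLp f).integrable (by norm_num)
  obtain ⟨C, hC⟩ := hc.exists_bound_of_continuous hφ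
  exact hf.bdd_smul C hφ.aestronglyMeasurable (Eventually.of_forall hC)

/-- `H^k((a, b); ℝ³)`: an element is the tuple `(u, u', …, u^(k))` of an `L²` function and its
weak derivatives, all of them in `L²`. The inner product and the norm are those of the `ℓ²`-product,
i.e. `‖u‖² = ∑_{j ≤ k} ‖u^(j)‖²_{L²}`. -/
def Sobolev (a b : ℝ) (k : ℕ) :
    Submodule ℝ (PiLp 2 (fun _ : Fin (k + 1) => Lp Vec3 2 (μI a b))) where
  carrier := {u | ∀ i : Fin k, IsWeakDeriv a b (u i.castSucc) (u i.succ)}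
  zero_mem' := by
    intro i φ _ _ _
    have h0 : ((0 : Lp Vec3 2 (μI a b)) : ℝ → Vec3) =ᵐ[μI a b] 0 := Lp.coeFn_zero _ _ _
    have h1 : ∀ ψ : ℝ → ℝ,
        ∫ x in Ioo a b, ψ x • ((0 : Lp Vec3 2 (μI a b)) : ℝ → Vec3) x = 0 := by
      intro ψ
      refine integral_eq_zero_of_ae ?_
      filter_upwards [h0] with x hx
      rw [hx]
      exact smul_zero _
    exact (h1 (deriv φ)).trans (by rw [← neg_zero, ← h1 φ]; rfl)
  add_mem' := by
    intro u v hu hv i φ h1 h2 h3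
    have key : ∀ (f g : Lp Vec3 2 (μI a b)) (ψ : ℝ → ℝ), Continuous ψ → HasCompactSupport ψ →
        ∫ x in Ioo a b, ψ x • ((f + g : Lp Vec3 2 (μI a b)) : ℝ → Vec3) x
          = (∫ x in Ioo a b, ψ x • f x) + ∫ x in Ioo a b, ψ x • g x := by
      intro f g ψ hψ hc
      rw [← integral_add (integrable_smul_Lp f hψ hc) (integrable_smul_Lp g hψ hc)]
      refine integral_congr_ae ?_
      filter_upwards [Lp.coeFn_add f g] with x hx
      rw [hx]
      exact smul_add _ _ _
    have hu' := hu i φ h1 h2 h3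
    have hv' := hv i φ h1 h2 h3
    simp only [PiLp.add_apply]
    rw [key _ _ _ (h1.continuous_deriv (by simp)) h2.deriv, key _ _ _ h1.continuous h2, hu', hv']
    abel
  smul_mem' := by
    intro c u hu i φ h1 h2 h3
    have key : ∀ (f : Lp Vec3 2 (μI a b)) (ψ : ℝ → ℝ),
        ∫ x in Ioo a b, ψ x • ((c • f : Lp Vec3 2 (μI a b)) : ℝ → Vec3) x
          = c • ∫ x in Ioo a b, ψ x • f x := by
      intro f ψ
      rw [← integral_smul]
      refine integral_congr_ae ?_
      filter_upwards [Lp.coeFn_smul c f] with x hx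
      simp only [hx, Pi.smul_apply]
      rw [smul_comm]
    have hu' := hu i φ h1 h2 h3
    simp only [PiLp.smul_apply]
    rw [key, key, hu', smul_neg]

/-- One-dimensional Sobolev embedding, scalar case: an integrable function with an integrable weak
derivative has a continuous representative on the closed interval. -/
theorem exists_continuous_rep_real {a b : ℝ} (hab : a < b) {f g : ℝ → ℝ}
    (hf : Integrable f (μI a b)) (hg : Integrable g (μI a b))
    (h : ∀ φ : ℝ → ℝ, ContDiff ℝ ∞ φ → HasCompactSupport φ → tsupport φ ⊆ Ioo a b →
      ∫ x in Ioo a b, deriv φ x * f x = - ∫ x in Ioo a b, φ x * g x) :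
    ∃ r : ℝ → ℝ, ContinuousOn r (Icc a b) ∧ f =ᵐ[μI a b] r := by
  have hgi : IntervalIntegrable g volume a b :=
    (intervalIntegrable_iff_integrableOn_Ioo_of_le hab.le).2 hg
  set G : ℝ → ℝ := fun x => ∫ t in a..x, g t with hG
  have hGac : AbsolutelyContinuousOnInterval G a b :=
    hgi.absolutelyContinuousOnInterval_intervalIntegral (by simp)
  have hGc : ContinuousOn G (Icc a b) := by
    have := hGac.continuousOn
    rwa [uIcc_of_le hab.le] at this
  have hGd : ∀ᵐ x, x ∈ Ioo a b → deriv G x = g x := by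
    filter_upwards [hgi.ae_hasDerivAt_integral] with x hx hxI
    exact (hx (by rw [uIcc_of_le hab.le]; exact Ioo_subset_Icc_self hxI) a (by simp)).deriv
  have hGint : Integrable G (μI a b) :=
    (hGc.integrableOn_Icc).mono_set Ioo_subset_Icc_self
  have hint : Integrable (fun x => f x - G x) (μI a b) := hf.sub hGint
  have hmul : ∀ (F ψ : ℝ → ℝ), Integrable F (μI a b) → Continuous ψ → HasCompactSupport ψ →
      Integrable (fun x => ψ x * F x) (μI a b) := by
    intro F ψ hF hψ hc
    obtain ⟨C, hC⟩ := hc.exists_bound_of_continuous hψ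
    exact hF.bdd_mul (c := C) hψ.aestronglyMeasurable (Eventually.of_forall hC)
  -- the difference `f - G` has vanishing weak derivative
  have h0 : ∀ φ : ℝ → ℝ, ContDiff ℝ ∞ φ → HasCompactSupport φ → tsupport φ ⊆ Ioo a b →
      ∫ x in Ioo a b, deriv φ x * (f x - G x) = 0 := by
    intro φ h1 h2 h3
    have hφd : Continuous (deriv φ) := h1.continuous_deriv (by simp)
    have hφa : φ a = 0 := image_eq_zero_of_notMem_tsupport fun hh => (h3 hh).1.false
    have hφb : φ b = 0 := image_eq_zero_of_notMem_tsupport fun hh => (h3 hh).2.false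
    have hφac : AbsolutelyContinuousOnInterval φ a b :=
      ((h1.of_le (by simp)).contDiffOn).absolutelyContinuousOnInterval
    have hparts := hGac.integral_mul_deriv_eq_deriv_mul hφac
    rw [intervalIntegral.integral_of_le hab.le, intervalIntegral.integral_of_le hab.le,
      integral_Ioc_eq_integral_Ioo, integral_Ioc_eq_integral_Ioo, hφa, hφb] at hparts
    have hcongr : ∫ x in Ioo a b, deriv G x * φ x = ∫ x in Ioo a b, φ x * g x := by
      refine setIntegral_congr_ae measurableSet_Ioo ?_
      filter_upwards [hGd] with x hx hxI
      rw [hx hxI, mul_comm]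
    have hcomm : ∫ x in Ioo a b, deriv φ x * G x = ∫ x in Ioo a b, G x * deriv φ x := by
      simp only [mul_comm]
    simp only [mul_sub]
    rw [integral_sub (hmul _ _ hf hφd h2.deriv) (hmul _ _ hGint hφd h2.deriv), h φ h1 h2 h3, hcomm,
      hparts, hcongr]
    ring
  -- a normalised bump function
  obtain ⟨ψ₀, hs₀, hc₀, ht₀, hi₀⟩ : ∃ ψ₀ : ℝ → ℝ, ContDiff ℝ ∞ ψ₀ ∧ HasCompactSupport ψ₀ ∧
      tsupport ψ₀ ⊆ Ioo a b ∧ ∫ x, ψ₀ x = 1 := by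
    let B : ContDiffBump ((a + b) / 2) :=
      ⟨(b - a) / 8, (b - a) / 4, by linarith, by linarith⟩
    refine ⟨B.normed volume, B.contDiff_normed, B.hasCompactSupport_normed, ?_, B.integral_normed⟩
    rw [B.tsupport_normed_eq, Real.closedBall_eq_Icc]
    intro x hx
    have h1 : (a + b) / 2 - (b - a) / 4 ≤ x := hx.1
    have h2 : x ≤ (a + b) / 2 + (b - a) / 4 := hx.2
    constructor <;> linarith
  set C : ℝ := ∫ x in Ioo a b, ψ₀ x * (f x - G x) with hC
  -- test functions with mean zero are derivatives of test functions
  have h1 : ∀ χ : ℝ → ℝ, ContDiff ℝ ∞ χ → HasCompactSupport χ → tsupport χ ⊆ Ioo a b →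
      ∫ x, χ x = 0 → ∫ x in Ioo a b, χ x * (f x - G x) = 0 := by
    intro χ hs hc ht hi
    have hcont : Continuous χ := hs.continuous
    have hd : ∀ x, HasDerivAt (fun y => ∫ t in a..y, χ t) (χ x) x := fun x =>
      intervalIntegral.integral_hasDerivAt_right (hcont.intervalIntegrable _ _)
        (hcont.stronglyMeasurableAtFilter _ _) hcont.continuousAt
    have hderiv : deriv (fun y => ∫ t in a..y, χ t) = χ := funext fun x => (hd x).deriv
    obtain ⟨c, d, hac, hdb, hcd⟩ : ∃ c d, a < c ∧ d < b ∧ tsupport χ ⊆ Icc c d := by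
      rcases (tsupport χ).eq_empty_or_nonempty with he | hne
      · exact ⟨(a + b) / 2, (a + b) / 2, by linarith, by linarith, by simp [he]⟩
      · have hK : IsCompact (tsupport χ) := hc
        exact ⟨sInf (tsupport χ), sSup (tsupport χ), (ht (hK.sInf_mem hne)).1,
          (ht (hK.sSup_mem hne)).2, fun x hx =>
            ⟨csInf_le hK.bddBelow hx, le_csSup hK.bddAbove hx⟩⟩
    have hz : ∀ t, t ∉ Icc c d → χ t = 0 := fun t hh =>
      image_eq_zero_of_notMem_tsupport fun h' => hh (hcd h')
    have hsupp : Function.support (fun y => ∫ t in a..y, χ t) ⊆ Icc c d := by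
      intro y hy
      by_contra hyn
      apply hy
      have hor : y < c ∨ d < y := by
        by_contra hcon
        push Not at hcon
        exact hyn ⟨hcon.1, hcon.2⟩
      rcases hor with hlt | hgt
      · have : ∫ t in a..y, χ t = ∫ t in a..y, (0 : ℝ) := by
          refine intervalIntegral.integral_congr fun t htt => hz t fun hh => ?_
          have : t ≤ max a y := htt.2
          have h3 : max a y < c := max_lt hac hlt
          linarith [hh.1]
        simpa using this
      · have e1 : ∫ t in a..y, χ t = (∫ t in a..b, χ t) + ∫ t in b..y, χ t :=
          (intervalIntegral.integral_add_adjacent_intervals (hcont.intervalIntegrable _ _)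
            (hcont.intervalIntegrable _ _)).symm
        have e2 : ∫ t in b..y, χ t = 0 := by
          have : ∫ t in b..y, χ t = ∫ t in b..y, (0 : ℝ) := by
            refine intervalIntegral.integral_congr fun t htt => hz t fun hh => ?_
            have : min b y ≤ t := htt.1
            have h3 : d < min b y := lt_min hdb hgt
            linarith [hh.2]
          simpa using this
        have e3 : ∫ t in a..b, χ t = ∫ t, χ t := by
          rw [intervalIntegral.integral_of_le hab.le]
          refine setIntegral_eq_integral_of_forall_compl_eq_zero fun t htn => ?_
          refine image_eq_zero_of_notMem_tsupport fun h' => htn (Ioo_subset_Ioc_self (ht h'))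
        simp only [e1, e2, e3, hi, add_zero]
    have hts : tsupport (fun y => ∫ t in a..y, χ t) ⊆ Icc c d :=
      closure_minimal hsupp isClosed_Icc
    have hsm : ContDiff ℝ ∞ (fun y => ∫ t in a..y, χ t) := by
      rw [contDiff_infty_iff_deriv]
      exact ⟨fun x => (hd x).differentiableAt, by rw [hderiv]; exact hs⟩
    have := h0 _ hsm (isCompact_Icc.of_isClosed_subset (isClosed_tsupport _) hts)
      (hts.trans fun x hx => ⟨hac.trans_le hx.1, hx.2.trans_lt hdb⟩)
    rwa [hderiv] at this
  -- hence `f - G` is a.e. equal to the constant `C`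
  have hfin : ∀ᵐ x, x ∈ Ioo a b → (f x - G x) - C = 0 := by
    refine IsOpen.ae_eq_zero_of_integral_contDiff_smul_eq_zero isOpen_Ioo ?_ ?_
    · have : IntegrableOn (fun x => (f x - G x) - C) (Ioo a b) volume :=
        hint.sub (integrable_const C)
      exact this.locallyIntegrableOn
    · intro ψ hs hc ht
      have hψi : Integrable ψ volume := hs.continuous.integrable_of_hasCompactSupport hc
      have h₀i : Integrable ψ₀ volume := hs₀.continuous.integrable_of_hasCompactSupport hc₀
      set m : ℝ := ∫ x, ψ x with hm
      have hcm : HasCompactSupport (fun x => m * ψ₀ x) := hc₀.mul_left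
      have hsub : tsupport (fun x => ψ x - m * ψ₀ x) ⊆ tsupport ψ ∪ tsupport ψ₀ := by
        refine closure_minimal ?_ ((isClosed_tsupport _).union (isClosed_tsupport _))
        intro x hx
        by_contra hn
        rw [mem_union, not_or] at hn
        apply hx
        simp [image_eq_zero_of_notMem_tsupport hn.1, image_eq_zero_of_notMem_tsupport hn.2]
      have hA := h1 (fun x => ψ x - m * ψ₀ x) (hs.sub (contDiff_const.mul hs₀)) (hc.sub hcm)
        (hsub.trans (union_subset ht ht₀))
        (by rw [integral_sub hψi (h₀i.const_mul m), integral_const_mul, hi₀]; simp [hm])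
      have hB : ∫ x in Ioo a b, (ψ x - m * ψ₀ x) * (f x - G x)
          = (∫ x in Ioo a b, ψ x * (f x - G x)) - m * C := by
        rw [hC, ← integral_const_mul, ← integral_sub (hmul _ _ hint hs.continuous hc)
          ((hmul _ _ hint hs₀.continuous hc₀).const_mul m)]
        refine integral_congr_ae (Eventually.of_forall fun x => ?_)
        simp only
        ring
      have hD : ∫ x, ψ x • ((f x - G x) - C)
          = ∫ x in Ioo a b, ψ x * ((f x - G x) - C) := by
        symm
        refine setIntegral_eq_integral_of_forall_compl_eq_zero fun t htn => ?_
        rw [image_eq_zero_of_notMem_tsupport fun h' => htn (ht h'), zero_mul]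
      have hE : ∫ x in Ioo a b, ψ x = m := by
        refine setIntegral_eq_integral_of_forall_compl_eq_zero fun t htn => ?_
        exact image_eq_zero_of_notMem_tsupport fun h' => htn (ht h')
      rw [hD]
      simp only [mul_sub _ _ C]
      rw [integral_sub (hmul _ _ hint hs.continuous hc) (hψi.restrict.mul_const C),
        integral_mul_const, hE, ← hB, hA]
  refine ⟨fun x => G x + C, hGc.add continuousOn_const, ?_⟩
  refine (ae_restrict_iff' measurableSet_Ioo).2 ?_
  filter_upwards [hfin] with x hx hxI
  linarith [hx hxI]

/-- All derivatives of order `< k` of a function in `H^k` have a continuous representative on the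
closed interval. -/
theorem exists_continuous_rep {a b : ℝ} {k : ℕ} (u : Sobolev a b k) (i : Fin k) :
    ∃ r : ℝ → Vec3, ContinuousOn r (Icc a b) ∧ (u.1 i.castSucc : ℝ → Vec3) =ᵐ[μI a b] r := by
  rcases le_or_gt b a with hba | hab
  · refine ⟨0, continuousOn_const, ?_⟩
    have : μI a b = 0 := by simp [μI, Ioo_eq_empty (not_lt.2 hba)]
    have h : ∀ᵐ x ∂(μI a b), False := by rw [this]; simp
    exact h.mono fun x hx => hx.elim
  have hI : ∀ f : Lp Vec3 2 (μI a b), Integrable f (μI a b) := fun f =>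
    (Lp.memLp f).integrable (by norm_num)
  have hj : ∀ j : Fin 3, ∃ r : ℝ → ℝ, ContinuousOn r (Icc a b) ∧
      (fun x => (u.1 i.castSucc : ℝ → Vec3) x j) =ᵐ[μI a b] r := by
    intro j
    have hL : ∀ f : Lp Vec3 2 (μI a b), Integrable (fun x => f x j) (μI a b) := fun f =>
      (EuclideanSpace.proj (𝕜 := ℝ) j).integrable_comp (hI f)
    refine exists_continuous_rep_real hab (hL _) (hL (u.1 i.succ)) ?_
    intro φ h1 h2 h3
    have key : ∀ (f : Lp Vec3 2 (μI a b)) (ψ : ℝ → ℝ), Continuous ψ → HasCompactSupport ψ →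
        ∫ x in Ioo a b, ψ x * f x j = (∫ x in Ioo a b, ψ x • f x) j := by
      intro f ψ hψ hc
      have := (EuclideanSpace.proj (𝕜 := ℝ) j).integral_comp_comm (integrable_smul_Lp f hψ hc)
      simpa using this
    rw [key _ _ (h1.continuous_deriv (by simp)) h2.deriv, key _ _ h1.continuous h2,
      u.2 i φ h1 h2 h3]
    rfl
  choose r hr1 hr2 using hj
  refine ⟨fun x => WithLp.toLp 2 (fun j => r j x), ?_, ?_⟩
  · exact (PiLp.continuous_toLp 2 _).comp_continuousOn (continuousOn_pi.2 hr1)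
  · have := ae_all_iff.2 hr2
    filter_upwards [this] with x hx
    ext j
    simpa using hx j

/-- The continuous representative on `[a, b]` of the `i`-th derivative of `u ∈ H^k`, `i < k`.
It is unique on `[a, b]` if `a < b`; its values off `[a, b]` are never used. -/
def rep {a b : ℝ} {k : ℕ} (u : Sobolev a b k) (i : Fin k) : ℝ → Vec3 :=
  Classical.choose (exists_continuous_rep u i)

/-- The Hilbert space `H²((a, b); ℝ³)`. -/
abbrev H2 (a b : ℝ) : Type := Sobolev a b 2

/-- `u(x)` for `u ∈ H²` and `x ∈ [a, b]`. -/
abbrev val {a b : ℝ} (u : H2 a b) : ℝ → Vec3 := rep u 0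

/-- `u'(x)` for `u ∈ H²` and `x ∈ [a, b]`. -/
abbrev der {a b : ℝ} (u : H2 a b) : ℝ → Vec3 := rep u 1

/-- The second derivative `u'' ∈ L²` of `u ∈ H²`. -/
abbrev der2 {a b : ℝ} (u : H2 a b) : Lp Vec3 2 (μI a b) := u.1 2

/-- `u ∈ H²` belongs to `H³`. -/
def MemH3 {a b : ℝ} (u : H2 a b) : Prop := ∃ w : Sobolev a b 3, w.1 0 = u.1 0

/-! ### The confinement -/

/-- `|y|_G = (y · G y)^{1/2}`. -/
def seminormG (G : Matrix (Fin 3) (Fin 3) ℝ) (y : Vec3) : ℝ :=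
  Real.sqrt (y.ofLp ⬝ᵥ G.mulVec y.ofLp)

/-- The composite quadratic confinement `D = ⋂_r {y : y · G_r y ≤ 1}`. -/
def confinement {R : ℕ} (G : Fin R → Matrix (Fin 3) (Fin 3) ℝ) : Set Vec3 :=
  {y | ∀ r, y.ofLp ⬝ᵥ (G r).mulVec y.ofLp ≤ 1}

/-- The potential `V_D(y) = ∑_r ½ (|y|_{D_r} - 1)_+²`. -/
def potential {R : ℕ} (G : Fin R → Matrix (Fin 3) (Fin 3) ℝ) (y : Vec3) : ℝ :=
  ∑ r, 1 / 2 * (max (seminormG (G r) y - 1) 0) ^ 2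

/-! ### Admissible curves and the limit energy -/

/-- `𝒜 ∩ D`: curves `u ∈ H²` with `|u'| = 1` a.e., `L_bc[u] = ℓ_bc`, and `u(x) ∈ D` for all
`x ∈ [a, b]`. -/
def admissibleConfined {a b : ℝ} {R m : ℕ} (G : Fin R → Matrix (Fin 3) (Fin 3) ℝ)
    (L : H2 a b →L[ℝ] EuclideanSpace ℝ (Fin m)) (ℓ : EuclideanSpace ℝ (Fin m)) : Set (H2 a b) :=
  {u | (∀ᵐ x ∂(μI a b), ‖(u.1 1 : ℝ → Vec3) x‖ = 1) ∧ L u = ℓ ∧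
    ∀ x ∈ Icc a b, val u x ∈ confinement G}

open Classical in
/-- `E_bend : H² → ℝ ∪ {+∞}`, finite exactly on `𝒜 ∩ D`. -/
def bendEnergy {a b : ℝ} {R m : ℕ} (κ : ℝ) (G : Fin R → Matrix (Fin 3) (Fin 3) ℝ)
    (L : H2 a b →L[ℝ] EuclideanSpace ℝ (Fin m)) (ℓ : EuclideanSpace ℝ (Fin m))
    (u : H2 a b) : EReal :=
  if u ∈ admissibleConfined G L ℓ then
    ((κ / 2 * ∫ x in Ioo a b, ‖der2 u x‖ ^ 2 : ℝ) : EReal)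
  else ⊤

/-- `L` is a boundary operator: `L v` depends only on `v(a), v'(a), v(b), v'(b)`. -/
def IsBoundaryOperator {a b : ℝ} {m : ℕ} (L : H2 a b →L[ℝ] EuclideanSpace ℝ (Fin m)) : Prop :=
  ∀ v w : H2 a b, val v a = val w a → der v a = der w a → val v b = val w b → der v b = der w b →
    L v = L w

/-! ### The discrete model -/

/-- A partition `a = x₀ < x₁ < … < x_N = b`. -/
structure IntervalPartition (a b : ℝ) where
  /-- the number of subintervals -/
  N : ℕ
  /-- the nodes -/
  x : Fin (N + 1) → ℝ
  strictMono : StrictMono x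
  first : x 0 = a
  last : x (Fin.last N) = b

/-- The maximal length `h` of the subintervals. -/
def IntervalPartition.mesh {a b : ℝ} (P : IntervalPartition a b) : ℝ :=
  ⨆ i : Fin P.N, (P.x i.succ - P.x i.castSucc)

/-- The piecewise linear nodal interpolant `𝓘_{1,h} f`, as the sum of `f(x₀)` and of one ramp for
each subinterval, which rises there from `0` to `f(x_{i+1}) - f(x_i)`. -/
def IntervalPartition.interp1 {a b : ℝ} (P : IntervalPartition a b) (f : ℝ → ℝ) (t : ℝ) : ℝ :=
  f (P.x 0) + ∑ i : Fin P.N, (f (P.x i.succ) - f (P.x i.castSucc)) *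
    max 0 (min 1 ((t - P.x i.castSucc) / (P.x i.succ - P.x i.castSucc)))

/-- `V_h³`: `C¹` curves on `[a, b]` whose components are polynomials of degree at most three on
each subinterval of the partition. -/
def splineSpace {a b : ℝ} (P : IntervalPartition a b) : Set (H2 a b) :=
  {v | ContDiffOn ℝ 1 (val v) (Icc a b) ∧
    ∀ (i : Fin P.N) (j : Fin 3), ∃ p : Polynomial ℝ, p.natDegree ≤ 3 ∧
      ∀ t ∈ Icc (P.x i.castSucc) (P.x i.succ), val v t j = p.eval t}

/-- `𝒜_h`: splines with `|u_h'(x_i)| = 1` at all nodes and `L_bc[u_h] = ℓ_bc`. -/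
def discreteAdmissible {a b : ℝ} {m : ℕ} (P : IntervalPartition a b)
    (L : H2 a b →L[ℝ] EuclideanSpace ℝ (Fin m)) (ℓ : EuclideanSpace ℝ (Fin m)) : Set (H2 a b) :=
  {v | v ∈ splineSpace P ∧ (∀ i, ‖der v (P.x i)‖ ^ 2 = 1) ∧ L v = ℓ}

open Classical in
/-- The discrete energy `E_{h,ε} : H² → ℝ ∪ {+∞}`. -/
def discreteEnergy {a b : ℝ} {R m : ℕ} (κ : ℝ) (G : Fin R → Matrix (Fin 3) (Fin 3) ℝ)
    (L : H2 a b →L[ℝ] EuclideanSpace ℝ (Fin m)) (ℓ : EuclideanSpace ℝ (Fin m))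
    (P : IntervalPartition a b) (ε : ℝ) (v : H2 a b) : EReal :=
  if v ∈ discreteAdmissible P L ℓ then
    ((κ / 2 * (∫ x in Ioo a b, ‖der2 v x‖ ^ 2) +
      1 / (2 * ε) * ∫ x in Ioo a b, P.interp1 (fun y => potential G (val v y)) x : ℝ) : EReal)
  else ⊤

/-- `v = 𝓘_{3,h} u` is the cubic Hermite interpolant of `u`: the spline with the values and first
derivatives of `u` at all nodes. -/
def IsHermiteInterpolant {a b : ℝ} (P : IntervalPartition a b) (u v : H2 a b) : Prop :=
  v ∈ splineSpace P ∧ ∀ i, val v (P.x i) = val u (P.x i) ∧ der v (P.x i) = der u (P.x i)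

end ConfinedRod

end

open ConfinedRod

/-! Both halves rest on one-dimensional Sobolev calculus. By du Bois-Reymond, an `H^k` function is a
primitive of its weak derivative (`rep_sub_rep`); Cauchy-Schwarz then makes it 1/2-Hölder with
constant the `L²` norm of that derivative (`norm_rep_sub_rep_le`). Hence point values of `u` and
`u'` are bounded linear maps on `H²`, and weak convergence implies pointwise convergence of both.

Liminf inequality. For a real `c` above the liminf, restrict the filter to the indices with energy
below `c` (`admissible_of_discreteEnergy_le`). Both energy terms are nonnegative, so `‖u_i''‖` stays
bounded and the penalty integral is at most `2εc`. The Hölder bound carries `|u_i'| = 1` from the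
nodes to every point with error of order `√h`, so the limit has unit speed. If the limit left `D` at
some point, equi-Lipschitz continuity would keep the interpolated potential above a positive
constant on a fixed interval, contradicting `2εc → 0`. Testing weak convergence with the limit's own
second derivative gives lower semicontinuity of the bending term.

Recovery. The Hermite interpolant is obtained by prescribing its piecewise linear second derivative
and integrating from the data of `u` at `a`; the coefficients make each cell end with the right
value and slope (`eq_at_nodes`). For `u` in `H³`, `u''` is continuous. Hermite interpolation
reproduces parabolas, so on each cell its second derivative differs from `u''` by at most 11 times
the oscillation bound (`norm_hermiteDer2_sub_le`). Uniform continuity and Poincaré give strong `H²`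
convergence. The penalty of the interpolant vanishes identically because its nodes lie in `D`, so no
coupling of `h` and `ε` is needed. -/

noncomputable section

namespace ConfinedRod

variable {a b : ℝ}

/-! ### Weak derivatives and primitives -/

/-- Integration by parts of a primitive against a test function, scalar case. -/
theorem integral_deriv_mul_primitive (hab : a < b) {g : ℝ → ℝ} (hg : Integrable g (μI a b))
    {φ : ℝ → ℝ} (h1 : ContDiff ℝ ∞ φ) (h3 : tsupport φ ⊆ Ioo a b) :
    ∫ x in Ioo a b, deriv φ x * (∫ t in a..x, g t) = - ∫ x in Ioo a b, φ x * g x := by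
  have hgi : IntervalIntegrable g volume a b :=
    (intervalIntegrable_iff_integrableOn_Ioo_of_le hab.le).2 hg
  have hGac : AbsolutelyContinuousOnInterval (fun x => ∫ t in a..x, g t) a b :=
    hgi.absolutelyContinuousOnInterval_intervalIntegral (by simp)
  have hGd : ∀ᵐ x, x ∈ Ioo a b → deriv (fun x => ∫ t in a..x, g t) x = g x := by
    filter_upwards [hgi.ae_hasDerivAt_integral] with x hx hxI
    exact (hx (by rw [uIcc_of_le hab.le]; exact Ioo_subset_Icc_self hxI) a (by simp)).deriv
  have hφa : φ a = 0 := image_eq_zero_of_notMem_tsupport fun hh => (h3 hh).1.false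
  have hφb : φ b = 0 := image_eq_zero_of_notMem_tsupport fun hh => (h3 hh).2.false
  have hφac : AbsolutelyContinuousOnInterval φ a b :=
    ((h1.of_le (by simp)).contDiffOn).absolutelyContinuousOnInterval
  have hparts := hGac.integral_mul_deriv_eq_deriv_mul hφac
  have hIoo : ∀ F : ℝ → ℝ, ∫ x in a..b, F x = ∫ x in Ioo a b, F x := fun F => by
    rw [intervalIntegral.integral_of_le hab.le, integral_Ioc_eq_integral_Ioo]
  rw [hφa, hφb, hIoo (fun x => (∫ t in a..x, g t) * deriv φ x),
    hIoo (fun x => deriv (fun x => ∫ t in a..x, g t) x * φ x)] at hparts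
  have hcongr : ∫ x in Ioo a b, deriv (fun x => ∫ t in a..x, g t) x * φ x
      = ∫ x in Ioo a b, φ x * g x := by
    refine setIntegral_congr_ae measurableSet_Ioo ?_
    filter_upwards [hGd] with x hx hxI
    rw [hx hxI, mul_comm]
  simp only [mul_comm (deriv φ _)]
  rw [hparts, hcongr]
  ring

theorem integrable_test_smul {E : Type*} [NormedAddCommGroup E] [NormedSpace ℝ E] {f : ℝ → E}
    (hf : Integrable f (μI a b)) {φ : ℝ → ℝ} (hφ : Continuous φ) (hc : HasCompactSupport φ) :
    Integrable (fun x => φ x • f x) (μI a b) := by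
  obtain ⟨C, hC⟩ := hc.exists_bound_of_continuous hφ
  exact hf.bdd_smul C hφ.aestronglyMeasurable (Eventually.of_forall hC)

theorem intervalIntegrable_of_mem {E : Type*} [NormedAddCommGroup E] {g : ℝ → E}
    (hg : Integrable g (μI a b)) {s t : ℝ} (hs : s ∈ Icc a b) (ht : t ∈ Icc a b) :
    IntervalIntegrable g volume s t := by
  have hab : a ≤ b := hs.1.trans hs.2
  have : IntervalIntegrable g volume a b :=
    (intervalIntegrable_iff_integrableOn_Ioo_of_le hab).2 hg
  refine this.mono_set ?_
  rw [uIcc_of_le hab]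
  exact uIcc_subset_Icc hs ht

theorem continuousOn_primitive {E : Type*} [NormedAddCommGroup E] [NormedSpace ℝ E]
    (hab : a < b) {g : ℝ → E} (hg : Integrable g (μI a b)) :
    ContinuousOn (fun x => ∫ t in a..x, g t) (Icc a b) := by
  have := intervalIntegral.continuousOn_primitive_interval (a := a) (b := b) (f := g)
    (μ := volume) (by
      rw [uIcc_of_le hab.le, integrableOn_Icc_iff_integrableOn_Ioo]; exact hg)
  rwa [uIcc_of_le hab.le] at this

theorem integral_deriv_test (hab : a < b) {φ : ℝ → ℝ} (h1 : ContDiff ℝ ∞ φ)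
    (h3 : tsupport φ ⊆ Ioo a b) : ∫ x in Ioo a b, deriv φ x = 0 := by
  have hφa : φ a = 0 := image_eq_zero_of_notMem_tsupport fun hh => (h3 hh).1.false
  have hφb : φ b = 0 := image_eq_zero_of_notMem_tsupport fun hh => (h3 hh).2.false
  rw [← integral_Ioc_eq_integral_Ioo, ← intervalIntegral.integral_of_le hab.le,
    intervalIntegral.integral_deriv_eq_sub (fun x _ => h1.differentiable (by simp) x)
      ((h1.continuous_deriv (by simp)).intervalIntegrable _ _), hφa, hφb, sub_zero]

/-- Any primitive of an integrable function has that function as its weak derivative. -/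
theorem isWeakDeriv_primitive (hab : a < b) {g : ℝ → Vec3} (hg : Integrable g (μI a b))
    (c : Vec3) : IsWeakDeriv a b (fun x => c + ∫ t in a..x, g t) g := by
  intro φ h1 h2 h3
  have hφd : Continuous (deriv φ) := h1.continuous_deriv (by simp)
  have hGi : Integrable (fun x => ∫ t in a..x, g t) (μI a b) :=
    ((continuousOn_primitive hab hg).integrableOn_Icc).mono_set Ioo_subset_Icc_self
  simp only [smul_add]
  rw [integral_add (integrable_test_smul (integrable_const c) hφd h2.deriv)
    (integrable_test_smul hGi hφd h2.deriv), integral_smul_const, integral_deriv_test hab h1 h3,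
    zero_smul, zero_add]
  -- Integration by parts is applied to scalar functions, so the identity is checked in each
  -- component.
  ext j
  have hp : ∀ F : ℝ → Vec3, Integrable F (μI a b) →
      (∫ x in Ioo a b, F x) j = ∫ x in Ioo a b, F x j := fun F hF =>
    ((EuclideanSpace.proj (𝕜 := ℝ) j).integral_comp_comm hF).symm
  rw [hp _ (integrable_test_smul hGi hφd h2.deriv)]
  have h4 : (-∫ x in Ioo a b, φ x • g x) j = -∫ x in Ioo a b, φ x * g x j := by
    rw [PiLp.neg_apply, hp _ (integrable_test_smul hg h1.continuous h2)]
    rfl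
  rw [h4, ← integral_deriv_mul_primitive (g := fun x => g x j) hab
    ((EuclideanSpace.proj (𝕜 := ℝ) j).integrable_comp hg) h1 h3]
  refine setIntegral_congr_fun measurableSet_Ioo fun x hx => ?_
  simp only [PiLp.smul_apply, smul_eq_mul]
  congr 1
  exact ((EuclideanSpace.proj (𝕜 := ℝ) j).intervalIntegral_comp_comm
    (intervalIntegrable_of_mem hg (left_mem_Icc.2 hab.le) (Ioo_subset_Icc_self hx))).symm

/-- A test function with mean zero is the derivative of a test function. -/
theorem exists_test_primitive (hab : a < b) {χ : ℝ → ℝ} (hs : ContDiff ℝ ∞ χ)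
    (hc : HasCompactSupport χ) (ht : tsupport χ ⊆ Ioo a b) (hi : ∫ x, χ x = 0) :
    ∃ ψ : ℝ → ℝ, ContDiff ℝ ∞ ψ ∧ HasCompactSupport ψ ∧ tsupport ψ ⊆ Ioo a b ∧ deriv ψ = χ := by
  have hcont : Continuous χ := hs.continuous
  have hd : ∀ x, HasDerivAt (fun y => ∫ t in a..y, χ t) (χ x) x := fun x =>
    intervalIntegral.integral_hasDerivAt_right (hcont.intervalIntegrable _ _)
      (hcont.stronglyMeasurableAtFilter _ _) hcont.continuousAt
  have hderiv : deriv (fun y => ∫ t in a..y, χ t) = χ := funext fun x => (hd x).deriv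
  obtain ⟨c, d, hac, hdb, hcd⟩ : ∃ c d, a < c ∧ d < b ∧ tsupport χ ⊆ Icc c d := by
    rcases (tsupport χ).eq_empty_or_nonempty with he | hne
    · exact ⟨(a + b) / 2, (a + b) / 2, by linarith, by linarith, by simp [he]⟩
    · have hK : IsCompact (tsupport χ) := hc
      exact ⟨sInf (tsupport χ), sSup (tsupport χ), (ht (hK.sInf_mem hne)).1,
        (ht (hK.sSup_mem hne)).2, fun x hx =>
          ⟨csInf_le hK.bddBelow hx, le_csSup hK.bddAbove hx⟩⟩
  have hz : ∀ t, t ∉ Icc c d → χ t = 0 := fun t hh =>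
    image_eq_zero_of_notMem_tsupport fun h' => hh (hcd h')
  -- Left of the support the integrand of the primitive is zero; right of it the primitive equals
  -- the full integral of `χ`, which is zero by `hi`.
  have hsupp : Function.support (fun y => ∫ t in a..y, χ t) ⊆ Icc c d := by
    intro y hy
    by_contra hyn
    apply hy
    have hor : y < c ∨ d < y := by
      by_contra hcon
      push Not at hcon
      exact hyn ⟨hcon.1, hcon.2⟩
    rcases hor with hlt | hgt
    · have : ∫ t in a..y, χ t = ∫ t in a..y, (0 : ℝ) := by
        refine intervalIntegral.integral_congr fun t htt => hz t fun hh => ?_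
        have : t ≤ max a y := htt.2
        have h3 : max a y < c := max_lt hac hlt
        linarith [hh.1]
      simpa using this
    · have e1 : ∫ t in a..y, χ t = (∫ t in a..b, χ t) + ∫ t in b..y, χ t :=
        (intervalIntegral.integral_add_adjacent_intervals (hcont.intervalIntegrable _ _)
          (hcont.intervalIntegrable _ _)).symm
      have e2 : ∫ t in b..y, χ t = 0 := by
        have : ∫ t in b..y, χ t = ∫ t in b..y, (0 : ℝ) := by
          refine intervalIntegral.integral_congr fun t htt => hz t fun hh => ?_
          have : min b y ≤ t := htt.1
          have h3 : d < min b y := lt_min hdb hgt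
          linarith [hh.2]
        simpa using this
      have e3 : ∫ t in a..b, χ t = ∫ t, χ t := by
        rw [intervalIntegral.integral_of_le hab.le]
        refine setIntegral_eq_integral_of_forall_compl_eq_zero fun t htn => ?_
        refine image_eq_zero_of_notMem_tsupport fun h' => htn (Ioo_subset_Ioc_self (ht h'))
      simp only [e1, e2, e3, hi, add_zero]
  have hts : tsupport (fun y => ∫ t in a..y, χ t) ⊆ Icc c d :=
    closure_minimal hsupp isClosed_Icc
  refine ⟨fun y => ∫ t in a..y, χ t, ?_, isCompact_Icc.of_isClosed_subset (isClosed_tsupport _) hts,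
    hts.trans fun x hx => ⟨hac.trans_le hx.1, hx.2.trans_lt hdb⟩, hderiv⟩
  rw [contDiff_infty_iff_deriv]
  exact ⟨fun x => (hd x).differentiableAt, by rw [hderiv]; exact hs⟩

/-- A function that integrates to zero against all test functions vanishes a.e. -/
theorem ae_eq_zero_of_integral_test {F : ℝ → Vec3} (hF : Integrable F (μI a b))
    (h : ∀ φ : ℝ → ℝ, ContDiff ℝ ∞ φ → HasCompactSupport φ → tsupport φ ⊆ Ioo a b →
      ∫ x in Ioo a b, φ x • F x = 0) : F =ᵐ[μI a b] 0 := by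
  refine (ae_restrict_iff' measurableSet_Ioo).2 ?_
  refine IsOpen.ae_eq_zero_of_integral_contDiff_smul_eq_zero isOpen_Ioo
    (IntegrableOn.locallyIntegrableOn hF) ?_
  intro ψ hs hc ht
  rw [← h ψ hs hc ht]
  symm
  refine setIntegral_eq_integral_of_forall_compl_eq_zero fun t htn => ?_
  rw [image_eq_zero_of_notMem_tsupport fun h' => htn (ht h'), zero_smul]

/-- The lemma of du Bois-Reymond: a function with vanishing weak derivative is constant. -/
theorem ae_eq_const_of_weakDeriv_zero (hab : a < b) {F : ℝ → Vec3} (hF : Integrable F (μI a b))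
    (h0 : ∀ φ : ℝ → ℝ, ContDiff ℝ ∞ φ → HasCompactSupport φ → tsupport φ ⊆ Ioo a b →
      ∫ x in Ioo a b, deriv φ x • F x = 0) : ∃ C : Vec3, ∀ᵐ x ∂(μI a b), F x = C := by
  obtain ⟨ψ₀, hs₀, hc₀, ht₀, hi₀⟩ : ∃ ψ₀ : ℝ → ℝ, ContDiff ℝ ∞ ψ₀ ∧ HasCompactSupport ψ₀ ∧
      tsupport ψ₀ ⊆ Ioo a b ∧ ∫ x, ψ₀ x = 1 := by
    let B : ContDiffBump ((a + b) / 2) :=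
      ⟨(b - a) / 8, (b - a) / 4, by linarith, by linarith⟩
    refine ⟨B.normed volume, B.contDiff_normed, B.hasCompactSupport_normed, ?_, B.integral_normed⟩
    rw [B.tsupport_normed_eq, Real.closedBall_eq_Icc]
    intro x hx
    have h1 : (a + b) / 2 - (b - a) / 4 ≤ x := hx.1
    have h2 : x ≤ (a + b) / 2 + (b - a) / 4 := hx.2
    constructor <;> linarith
  -- The constant must be the mean of `F` against the normalised bump. Any test function `ψ` minus
  -- `m • ψ₀` has mean zero, hence is a derivative and annihilates `F`.
  set C : Vec3 := ∫ x in Ioo a b, ψ₀ x • F x with hC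
  have hz : (fun x => F x - C) =ᵐ[μI a b] 0 := by
    refine ae_eq_zero_of_integral_test (hF.sub (integrable_const C)) fun ψ hs hc ht => ?_
    have hψi : Integrable ψ volume := hs.continuous.integrable_of_hasCompactSupport hc
    have h₀i : Integrable ψ₀ volume := hs₀.continuous.integrable_of_hasCompactSupport hc₀
    set m : ℝ := ∫ x, ψ x with hm
    have hcm : HasCompactSupport (fun x => m * ψ₀ x) := hc₀.mul_left
    have hsub : tsupport (fun x => ψ x - m * ψ₀ x) ⊆ tsupport ψ ∪ tsupport ψ₀ := by
      refine closure_minimal ?_ ((isClosed_tsupport _).union (isClosed_tsupport _))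
      intro x hx
      by_contra hn
      rw [mem_union, not_or] at hn
      apply hx
      simp [image_eq_zero_of_notMem_tsupport hn.1, image_eq_zero_of_notMem_tsupport hn.2]
    obtain ⟨η, hη1, hη2, hη3, hη4⟩ := exists_test_primitive hab
      (hs.sub (contDiff_const.mul hs₀)) (hc.sub hcm) (hsub.trans (union_subset ht ht₀))
      (by rw [integral_sub hψi (h₀i.const_mul m), integral_const_mul, hi₀]; simp [hm])
    have hA := h0 η hη1 hη2 hη3
    simp only [hη4, sub_smul, mul_smul] at hA
    rw [integral_sub (g := fun x => m • ψ₀ x • F x) (integrable_test_smul hF hs.continuous hc)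
      ((integrable_test_smul hF hs₀.continuous hc₀).smul m), integral_smul, ← hC] at hA
    have hE : ∫ x in Ioo a b, ψ x = m := by
      refine setIntegral_eq_integral_of_forall_compl_eq_zero fun t htn => ?_
      exact image_eq_zero_of_notMem_tsupport fun h' => htn (ht h')
    simp only [smul_sub]
    rw [integral_sub (integrable_test_smul hF hs.continuous hc)
      (integrable_test_smul (integrable_const C) hs.continuous hc), integral_smul_const, hE, hA]
  refine ⟨C, hz.mono fun x hx => ?_⟩
  exact sub_eq_zero.1 hx

/-- A function is a primitive of its weak derivative. -/
theorem IsWeakDeriv.ae_eq_primitive (hab : a < b) {f g : ℝ → Vec3} (hf : Integrable f (μI a b))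
    (hg : Integrable g (μI a b)) (h : IsWeakDeriv a b f g) :
    ∃ c : Vec3, f =ᵐ[μI a b] fun x => c + ∫ t in a..x, g t := by
  have hGi : Integrable (fun x => ∫ t in a..x, g t) (μI a b) :=
    ((continuousOn_primitive hab hg).integrableOn_Icc).mono_set Ioo_subset_Icc_self
  obtain ⟨c, hc⟩ := ae_eq_const_of_weakDeriv_zero hab (hf.sub hGi) fun φ h1 h2 h3 => by
    have hφd : Continuous (deriv φ) := h1.continuous_deriv (by simp)
    have hp := isWeakDeriv_primitive hab hg 0 φ h1 h2 h3
    simp only [zero_add] at hp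
    simp only [Pi.sub_apply, smul_sub]
    rw [integral_sub (integrable_test_smul hf hφd h2.deriv)
      (integrable_test_smul hGi hφd h2.deriv), h φ h1 h2 h3, hp, sub_self]
  refine ⟨c, hc.mono fun x hx => ?_⟩
  exact sub_eq_iff_eq_add.1 hx

/-- Weak derivatives are unique. -/
theorem IsWeakDeriv.ae_unique {f f' g g' : ℝ → Vec3} (hff : f =ᵐ[μI a b] f')
    (hg : Integrable g (μI a b)) (hg' : Integrable g' (μI a b)) (h : IsWeakDeriv a b f g)
    (h' : IsWeakDeriv a b f' g') : g =ᵐ[μI a b] g' := by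
  have := ae_eq_zero_of_integral_test (hg.sub hg') fun φ h1 h2 h3 => by
    have e : ∫ x in Ioo a b, deriv φ x • f x = ∫ x in Ioo a b, deriv φ x • f' x :=
      integral_congr_ae (hff.mono fun x hx => by simp only [hx])
    rw [h φ h1 h2 h3, h' φ h1 h2 h3, neg_inj] at e
    simp only [Pi.sub_apply, smul_sub]
    rw [integral_sub (integrable_test_smul hg h1.continuous h2)
      (integrable_test_smul hg' h1.continuous h2), e, sub_self]
  exact this.mono fun x hx => sub_eq_zero.1 hx

/-! ### Continuous representatives and Sobolev embedding -/

theorem integrable_Lp (f : Lp Vec3 2 (μI a b)) : Integrable f (μI a b) :=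
  (Lp.memLp f).integrable (by norm_num)

theorem continuousOn_rep {k : ℕ} (u : Sobolev a b k) (i : Fin k) :
    ContinuousOn (rep u i) (Icc a b) :=
  (Classical.choose_spec (exists_continuous_rep u i)).1

theorem ae_eq_rep {k : ℕ} (u : Sobolev a b k) (i : Fin k) :
    (u.1 i.castSucc : ℝ → Vec3) =ᵐ[μI a b] rep u i :=
  (Classical.choose_spec (exists_continuous_rep u i)).2

/-- The continuous representative is unique. -/
theorem eqOn_of_ae_eq (hab : a < b) {f g : ℝ → Vec3} (hf : ContinuousOn f (Icc a b))
    (hg : ContinuousOn g (Icc a b)) (h : f =ᵐ[μI a b] g) : EqOn f g (Icc a b) := by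
  refine Measure.eqOn_Icc_of_ae_eq volume hab.ne ?_ hf hg
  rwa [← Measure.restrict_congr_set (μ := volume) Ioo_ae_eq_Icc]

theorem rep_eqOn (hab : a < b) {k : ℕ} (u : Sobolev a b k) (i : Fin k) {r : ℝ → Vec3}
    (hr : ContinuousOn r (Icc a b)) (h : (u.1 i.castSucc : ℝ → Vec3) =ᵐ[μI a b] r) :
    EqOn (rep u i) r (Icc a b) :=
  eqOn_of_ae_eq hab (continuousOn_rep u i) hr ((ae_eq_rep u i).symm.trans h)

/-- The fundamental theorem of calculus for Sobolev functions. -/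
theorem rep_sub_rep (hab : a < b) {k : ℕ} (u : Sobolev a b k) (i : Fin k) {x y : ℝ}
    (hx : x ∈ Icc a b) (hy : y ∈ Icc a b) :
    rep u i y - rep u i x = ∫ t in x..y, (u.1 i.succ : ℝ → Vec3) t := by
  have hg := integrable_Lp (u.1 i.succ)
  obtain ⟨c, hc⟩ := IsWeakDeriv.ae_eq_primitive hab (integrable_Lp _) hg (u.2 i)
  have hE := rep_eqOn hab u i (continuousOn_const.add (continuousOn_primitive hab hg)) hc
  have ha : a ∈ Icc a b := left_mem_Icc.2 hab.le
  rw [hE hx, hE hy, ← intervalIntegral.integral_interval_sub_left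
    (intervalIntegrable_of_mem hg ha hy) (intervalIntegrable_of_mem hg ha hx)]
  simp

theorem der_sub_der (hab : a < b) (u : H2 a b) {x y : ℝ} (hx : x ∈ Icc a b) (hy : y ∈ Icc a b) :
    der u y - der u x = ∫ t in x..y, der2 u t :=
  rep_sub_rep hab u 1 hx hy

theorem val_sub_val (hab : a < b) (u : H2 a b) {x y : ℝ} (hx : x ∈ Icc a b) (hy : y ∈ Icc a b) :
    val u y - val u x = ∫ t in x..y, der u t := by
  have h := rep_sub_rep hab u 0 hx hy
  refine h.trans (intervalIntegral.integral_congr_ae_restrict ?_)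
  have h1 : (u.1 1 : ℝ → Vec3) =ᵐ[μI a b] der u := ae_eq_rep u 1
  have h2 : (u.1 1 : ℝ → Vec3) =ᵐ[volume.restrict (Icc a b)] der u := by
    rwa [← Measure.restrict_congr_set (μ := volume) Ioo_ae_eq_Icc]
  exact ae_restrict_of_ae_restrict_of_subset
    (uIoc_subset_uIcc.trans (uIcc_subset_Icc hx hy)) h2

theorem integrable_norm_sq_Lp (g : Lp Vec3 2 (μI a b)) :
    Integrable (fun x => ‖g x‖ ^ 2) (μI a b) :=
  (Lp.memLp g).integrable_norm_pow (by norm_num)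

theorem integral_norm_sq_Lp (g : Lp Vec3 2 (μI a b)) :
    ∫ x in Ioo a b, ‖g x‖ ^ 2 = ‖g‖ ^ 2 := by
  have h : inner ℝ g g = ∫ x in Ioo a b, inner ℝ (g x) (g x) := rfl
  simp only [real_inner_self_eq_norm_sq] at h
  exact h.symm

/-- The Cauchy–Schwarz inequality on a subinterval. -/
theorem sq_integral_norm_le {s t : ℝ} (hs : s ∈ Icc a b) (ht : t ∈ Icc a b) (hst : s ≤ t)
    (g : Lp Vec3 2 (μI a b)) : (∫ x in s..t, ‖g x‖) ^ 2 ≤ (t - s) * ‖g‖ ^ 2 := by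
  rcases hst.eq_or_lt with rfl | hlt
  · simp
  have hab : a ≤ b := hs.1.trans hs.2
  have hi : IntervalIntegrable (fun x => ‖g x‖) volume s t :=
    intervalIntegrable_of_mem (integrable_Lp g).norm hs ht
  have hi2 : IntervalIntegrable (fun x => ‖g x‖ ^ 2) volume s t :=
    intervalIntegrable_of_mem (integrable_norm_sq_Lp g) hs ht
  -- Cauchy-Schwarz in variance form: with `m` the mean of `‖g‖`, the integral of `(‖g‖ - m)²` is
  -- nonnegative.
  set m : ℝ := (∫ x in s..t, ‖g x‖) / (t - s) with hm
  have hpos : 0 < t - s := sub_pos.2 hlt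
  have hA : (∫ x in s..t, ‖g x‖) = m * (t - s) := by
    rw [hm]; field_simp
  have h0 : 0 ≤ ∫ x in s..t, (‖g x‖ - m) ^ 2 :=
    intervalIntegral.integral_nonneg hst fun x _ => sq_nonneg _
  have h1 : ∫ x in s..t, (‖g x‖ - m) ^ 2
      = (∫ x in s..t, ‖g x‖ ^ 2) - 2 * m * (∫ x in s..t, ‖g x‖) + m ^ 2 * (t - s) := by
    have : ∀ x, (‖g x‖ - m) ^ 2 = (‖g x‖ ^ 2 - 2 * m * ‖g x‖) + m ^ 2 := fun x => by ring
    simp only [this]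
    rw [intervalIntegral.integral_add (hi2.sub (hi.const_mul _)) (by simp),
      intervalIntegral.integral_sub hi2 (hi.const_mul _), intervalIntegral.integral_const_mul,
      intervalIntegral.integral_const, smul_eq_mul]
    ring
  have h2 : ∫ x in s..t, ‖g x‖ ^ 2 ≤ ‖g‖ ^ 2 := by
    rw [← integral_norm_sq_Lp, intervalIntegral.integral_of_le hst, integral_Ioc_eq_integral_Ioo]
    exact setIntegral_mono_set (integrable_norm_sq_Lp g)
      (Eventually.of_forall fun x => sq_nonneg _)
      (Ioo_subset_Ioo hs.1 ht.2).eventuallyLE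
  rw [h1, hA] at h0
  rw [hA]
  nlinarith

theorem norm_integral_Lp_le {s t : ℝ} (hs : s ∈ Icc a b) (ht : t ∈ Icc a b)
    (g : Lp Vec3 2 (μI a b)) : ‖∫ x in s..t, g x‖ ≤ Real.sqrt |t - s| * ‖g‖ := by
  wlog hst : s ≤ t generalizing s t
  · rw [intervalIntegral.integral_symm, norm_neg, abs_sub_comm]
    exact this ht hs (le_of_not_ge hst)
  refine (intervalIntegral.norm_integral_le_integral_norm hst).trans ?_
  refine abs_le_of_sq_le_sq' ?_ (by positivity) |>.2
  rw [mul_pow, Real.sq_sqrt (abs_nonneg _), abs_of_nonneg (sub_nonneg.2 hst)]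
  exact sq_integral_norm_le hs ht hst g

/-- Functions in `H¹` are Hölder continuous with exponent `1/2`. -/
theorem norm_rep_sub_rep_le (hab : a < b) {k : ℕ} (u : Sobolev a b k) (i : Fin k) {x y : ℝ}
    (hx : x ∈ Icc a b) (hy : y ∈ Icc a b) :
    ‖rep u i y - rep u i x‖ ≤ Real.sqrt |y - x| * ‖u.1 i.succ‖ := by
  rw [rep_sub_rep hab u i hx hy]
  exact norm_integral_Lp_le hx hy _

theorem integral_rep (hab : a < b) {k : ℕ} (u : Sobolev a b k) (i : Fin k) :
    ∫ x in a..b, rep u i x = ∫ x in a..b, (u.1 i.castSucc : ℝ → Vec3) x := by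
  rw [intervalIntegral.integral_of_le hab.le, intervalIntegral.integral_of_le hab.le,
    integral_Ioc_eq_integral_Ioo, integral_Ioc_eq_integral_Ioo]
  exact integral_congr_ae (ae_eq_rep u i).symm

theorem norm_apply_le_norm {k : ℕ} (u : Sobolev a b k) (j : Fin (k + 1)) : ‖u.1 j‖ ≤ ‖u‖ :=
  PiLp.norm_apply_le u.1 j

/-- The Sobolev embedding into bounded functions. -/
theorem norm_rep_le (hab : a < b) {k : ℕ} (u : Sobolev a b k) (i : Fin k) {x : ℝ}
    (hx : x ∈ Icc a b) :
    ‖rep u i x‖ ≤ (Real.sqrt (b - a) / (b - a) + Real.sqrt (b - a)) * ‖u‖ := by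
  have hpos : 0 < b - a := sub_pos.2 hab
  have hrep : IntervalIntegrable (rep u i) volume a b :=
    (continuousOn_rep u i).intervalIntegrable_of_Icc hab.le
  -- The value at `x` is the mean over the interval minus the mean deviation; the former is
  -- controlled by the `L²` norm, the latter by the Hölder bound.
  have h1 : (b - a) • rep u i x
      = (∫ y in a..b, rep u i y) - ∫ y in a..b, (rep u i y - rep u i x) := by
    rw [intervalIntegral.integral_sub hrep (by simp), intervalIntegral.integral_const]
    simp
  have h2 : ‖∫ y in a..b, rep u i y‖ ≤ Real.sqrt (b - a) * ‖u‖ := by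
    rw [integral_rep hab]
    have := norm_integral_Lp_le (left_mem_Icc.2 hab.le) (right_mem_Icc.2 hab.le) (u.1 i.castSucc)
    rw [abs_of_pos hpos] at this
    exact this.trans (by gcongr; exact norm_apply_le_norm u _)
  have h3 : ‖∫ y in a..b, (rep u i y - rep u i x)‖ ≤ Real.sqrt (b - a) * ‖u‖ * |b - a| := by
    refine intervalIntegral.norm_integral_le_of_norm_le_const fun y hy => ?_
    rw [uIoc_of_le hab.le] at hy
    have hy' : y ∈ Icc a b := Ioc_subset_Icc_self hy
    refine (norm_rep_sub_rep_le hab u i hx hy').trans ?_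
    gcongr
    · rw [abs_le]; constructor <;> linarith [hx.1, hx.2, hy'.1, hy'.2]
    · exact norm_apply_le_norm u _
  have h4 : (b - a) * ‖rep u i x‖ ≤ Real.sqrt (b - a) * ‖u‖ + Real.sqrt (b - a) * ‖u‖ * (b - a) := by
    have := norm_sub_le (∫ y in a..b, rep u i y) (∫ y in a..b, (rep u i y - rep u i x))
    rw [← h1, norm_smul, Real.norm_of_nonneg hpos.le] at this
    rw [abs_of_pos hpos] at h3
    linarith
  rw [← mul_le_mul_iff_right₀ hpos]
  refine h4.trans (le_of_eq ?_)
  field_simp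

theorem rep_add (hab : a < b) {k : ℕ} (u v : Sobolev a b k) (i : Fin k) {x : ℝ}
    (hx : x ∈ Icc a b) : rep (u + v) i x = rep u i x + rep v i x := by
  refine rep_eqOn hab (u + v) i ((continuousOn_rep u i).add (continuousOn_rep v i)) ?_ hx
  have h : ((u + v).1 i.castSucc : ℝ → Vec3) =ᵐ[μI a b] _ :=
    Lp.coeFn_add (u.1 i.castSucc) (v.1 i.castSucc)
  exact h.trans ((ae_eq_rep u i).add (ae_eq_rep v i))

theorem rep_smul (hab : a < b) {k : ℕ} (c : ℝ) (u : Sobolev a b k) (i : Fin k) {x : ℝ}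
    (hx : x ∈ Icc a b) : rep (c • u) i x = c • rep u i x := by
  refine rep_eqOn hab (c • u) i ((continuousOn_rep u i).const_smul c) ?_ hx
  have h : ((c • u).1 i.castSucc : ℝ → Vec3) =ᵐ[μI a b] _ := Lp.coeFn_smul c (u.1 i.castSucc)
  exact h.trans ((ae_eq_rep u i).const_smul c)

/-! ### Bounded linear maps and weak convergence -/

/-- Evaluation of the `i`-th derivative at a point is a bounded linear map. -/
def evalCLM (hab : a < b) {k : ℕ} (i : Fin k) {x : ℝ} (hx : x ∈ Icc a b) :
    Sobolev a b k →L[ℝ] Vec3 :=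
  LinearMap.mkContinuous
    { toFun := fun u => rep u i x
      map_add' := fun u v => rep_add hab u v i hx
      map_smul' := fun c u => rep_smul hab c u i hx }
    (Real.sqrt (b - a) / (b - a) + Real.sqrt (b - a)) fun u => norm_rep_le hab u i hx

/-- The highest derivative as a bounded linear map into `L²`. -/
def der2CLM (a b : ℝ) : H2 a b →L[ℝ] Lp Vec3 2 (μI a b) :=
  (PiLp.proj 2 (fun _ : Fin 3 => Lp Vec3 2 (μI a b)) (2 : Fin 3)).comp (Sobolev a b 2).subtypeL

theorem tendsto_of_weak {ι H : Type*} [NormedAddCommGroup H] [NormedSpace ℝ H] {l : Filter ι}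
    {u : ι → H} {v : H}
    (h : Tendsto (fun i => toWeakSpace ℝ H (u i)) l (𝓝 (toWeakSpace ℝ H v))) (T : H →L[ℝ] ℝ) :
    Tendsto (fun i => T (u i)) l (𝓝 (T v)) := by
  have hc : Continuous fun x : WeakSpace ℝ H => T ((toWeakSpace ℝ H).symm x) :=
    WeakBilin.eval_continuous (topDualPairing ℝ H).flip T
  exact (hc.tendsto _).comp h

/-- In a finite-dimensional target, convergence can be tested on coordinates, each of which is a
bounded functional. This turns weak `H²` convergence into convergence of boundary data and point
values. -/
theorem tendsto_of_weak_euclidean {ι H : Type*} [NormedAddCommGroup H] [NormedSpace ℝ H]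
    {l : Filter ι} {u : ι → H} {v : H} {n : ℕ}
    (h : Tendsto (fun i => toWeakSpace ℝ H (u i)) l (𝓝 (toWeakSpace ℝ H v)))
    (T : H →L[ℝ] EuclideanSpace ℝ (Fin n)) : Tendsto (fun i => T (u i)) l (𝓝 (T v)) := by
  have : Tendsto (fun i => (T (u i)).ofLp) l (𝓝 (T v).ofLp) :=
    tendsto_pi_nhds.2 fun j => tendsto_of_weak h ((EuclideanSpace.proj (𝕜 := ℝ) j).comp T)
  exact ((PiLp.continuous_toLp 2 _).tendsto _).comp this

/-! ### Curves built from their second derivative -/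

theorem memLp_of_continuousOn {f : ℝ → Vec3} (hf : ContinuousOn f (Icc a b)) :
    MemLp f 2 (μI a b) := by
  obtain ⟨C, hC⟩ := isCompact_Icc.exists_bound_of_continuousOn hf
  refine MemLp.of_bound
    ((hf.mono Ioo_subset_Icc_self).aestronglyMeasurable measurableSet_Ioo) C ?_
  filter_upwards [ae_restrict_mem measurableSet_Ioo] with x hx
  exact hC x (Ioo_subset_Icc_self hx)

theorem IsWeakDeriv.congr_ae {f f' g g' : ℝ → Vec3} (h : IsWeakDeriv a b f g)
    (hf : f' =ᵐ[μI a b] f) (hg : g' =ᵐ[μI a b] g) : IsWeakDeriv a b f' g' := by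
  intro φ h1 h2 h3
  rw [integral_congr_ae (g := fun x => deriv φ x • f x) (hf.mono fun x hx => by simp only [hx]),
    integral_congr_ae (μ := μI a b) (f := fun x => φ x • g' x) (g := fun x => φ x • g x)
      (hg.mono fun x hx => by simp only [hx])]
  exact h φ h1 h2 h3

/-- A curve in `H²` is determined by its initial data and an arbitrary second derivative in
`L²`. -/
theorem exists_H2_of_der2 (hab : a < b) (p d : Vec3) {g : ℝ → Vec3} (hg : MemLp g 2 (μI a b)) :
    ∃ u : H2 a b, der2 u =ᵐ[μI a b] g ∧ val u a = p ∧ der u a = d := by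
  have hgi : Integrable g (μI a b) := hg.integrable (by norm_num)
  have hc1 : ContinuousOn (fun x => d + ∫ t in a..x, g t) (Icc a b) :=
    continuousOn_const.add (continuousOn_primitive hab hgi)
  set f1 : ℝ → Vec3 := fun x => d + ∫ t in a..x, g t with hf1
  have hm1 := memLp_of_continuousOn hc1
  have hi1 : Integrable f1 (μI a b) := hm1.integrable (by norm_num)
  have hc0 : ContinuousOn (fun x => p + ∫ t in a..x, f1 t) (Icc a b) :=
    continuousOn_const.add (continuousOn_primitive hab hi1)
  set f0 : ℝ → Vec3 := fun x => p + ∫ t in a..x, f1 t with hf0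
  have hm0 := memLp_of_continuousOn hc0
  let w : PiLp 2 (fun _ : Fin 3 => Lp Vec3 2 (μI a b)) :=
    WithLp.toLp 2 ![hm0.toLp f0, hm1.toLp f1, hg.toLp g]
  have hw : w ∈ Sobolev a b 2 := by
    intro i
    fin_cases i
    · exact (isWeakDeriv_primitive hab hi1 p).congr_ae hm0.coeFn_toLp hm1.coeFn_toLp
    · exact (isWeakDeriv_primitive hab hgi d).congr_ae hm1.coeFn_toLp hg.coeFn_toLp
  have ha : a ∈ Icc a b := left_mem_Icc.2 hab.le
  refine ⟨⟨w, hw⟩, hg.coeFn_toLp, ?_, ?_⟩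
  · refine (rep_eqOn hab ⟨w, hw⟩ 0 hc0 hm0.coeFn_toLp ha).trans ?_
    simp [hf0]
  · refine (rep_eqOn hab ⟨w, hw⟩ 1 hc1 hm1.coeFn_toLp ha).trans ?_
    simp [hf1]

theorem der_eq_of_der2 (hab : a < b) {u : H2 a b} {g : ℝ → Vec3} (h : der2 u =ᵐ[μI a b] g)
    {x y : ℝ} (hx : x ∈ Icc a b) (hy : y ∈ Icc a b) :
    der u y = der u x + ∫ t in x..y, g t := by
  rw [← sub_eq_iff_eq_add', der_sub_der hab u hx hy]
  refine intervalIntegral.integral_congr_ae_restrict ?_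
  have h2 : (der2 u : ℝ → Vec3) =ᵐ[volume.restrict (Icc a b)] g := by
    rwa [← Measure.restrict_congr_set (μ := volume) Ioo_ae_eq_Icc]
  exact ae_restrict_of_ae_restrict_of_subset
    (uIoc_subset_uIcc.trans (uIcc_subset_Icc hx hy)) h2

theorem hasDerivWithinAt_val (hab : a < b) (u : H2 a b) {x : ℝ} (hx : x ∈ Icc a b) :
    HasDerivWithinAt (val u) (der u x) (Icc a b) x := by
  have hc := continuousOn_rep u 1
  have ha : a ∈ Icc a b := left_mem_Icc.2 hab.le
  have h : HasDerivWithinAt (fun y => val u a + ∫ t in a..y, der u t) (der u x) (Icc a b) x := by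
    -- The fundamental theorem relative to `Icc a b` finds its one-sided filters by an instance that
    -- takes the membership as a `Fact`.
    have : Fact (x ∈ Icc a b) := ⟨hx⟩
    refine HasDerivWithinAt.const_add _ ?_
    exact intervalIntegral.integral_hasDerivWithinAt_right
      ((hc.mono (Icc_subset_Icc_right hx.2)).intervalIntegrable_of_Icc hx.1)
      (hc.stronglyMeasurableAtFilter_nhdsWithin measurableSet_Icc x) (hc x hx)
  refine h.congr (fun y hy => ?_) ?_
  · rw [← val_sub_val hab u ha hy]; abel
  · rw [← val_sub_val hab u ha hx]; abel

theorem contDiffOn_val (hab : a < b) (u : H2 a b) : ContDiffOn ℝ 1 (val u) (Icc a b) := by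
  have hd : ∀ x ∈ Icc a b, derivWithin (val u) (Icc a b) x = der u x := fun x hx =>
    (hasDerivWithinAt_val hab u hx).derivWithin (uniqueDiffOn_Icc hab x hx)
  rw [contDiffOn_one_iff_derivWithin (uniqueDiffOn_Icc hab)]
  exact ⟨fun x hx => (hasDerivWithinAt_val hab u hx).differentiableWithinAt,
    (continuousOn_rep u 1).congr hd⟩

/-! ### Partitions and piecewise linear interpolation -/

namespace IntervalPartition

variable (P : IntervalPartition a b)

theorem node_mem (i : Fin (P.N + 1)) : P.x i ∈ Icc a b := by
  constructor
  · exact P.first.symm.le.trans (P.strictMono.monotone (Fin.zero_le i))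
  · exact (P.strictMono.monotone (Fin.le_last i)).trans P.last.le

theorem cell_pos (i : Fin P.N) : 0 < P.x i.succ - P.x i.castSucc :=
  sub_pos.2 (P.strictMono Fin.castSucc_lt_succ)

theorem cell_le_mesh (i : Fin P.N) : P.x i.succ - P.x i.castSucc ≤ P.mesh :=
  le_ciSup (f := fun i : Fin P.N => P.x i.succ - P.x i.castSucc) (finite_range _).bddAbove i

/-- The half-open cells cover the half-open interval. -/
theorem exists_cell_Ioc {t : ℝ} (ht : t ∈ Ioc a b) :
    ∃ i : Fin P.N, t ∈ Ioc (P.x i.castSucc) (P.x i.succ) := by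
  have key : ∀ k : Fin (P.N + 1), t ≤ P.x k →
      ∃ i : Fin P.N, t ∈ Ioc (P.x i.castSucc) (P.x i.succ) := by
    intro k
    induction k using Fin.induction with
    | zero =>
      intro h
      rw [P.first] at h
      exact absurd ht.1 (not_lt.2 h)
    | succ k ih =>
      intro hk
      rcases lt_or_ge (P.x k.castSucc) t with h | h
      · exact ⟨k, h, hk⟩
      · exact ih h
  exact key (Fin.last _) (ht.2.trans P.last.symm.le)

/-- Every point of the interval lies in a cell of the partition. -/
theorem exists_cell (hab : a < b) {t : ℝ} (ht : t ∈ Icc a b) :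
    ∃ i : Fin P.N, t ∈ Icc (P.x i.castSucc) (P.x i.succ) := by
  rcases ht.1.eq_or_lt with rfl | hat
  -- Half-open cells miss `a`. The cell containing `b` serves only to show that there is a cell at
  -- all, so that the first one exists.
  · obtain ⟨i, -⟩ := P.exists_cell_Ioc (right_mem_Ioc.2 hab)
    exact ⟨⟨0, i.pos⟩, P.first.le, (P.node_mem _).1⟩
  · obtain ⟨i, hi⟩ := P.exists_cell_Ioc ⟨hat, ht.2⟩
    exact ⟨i, Ioc_subset_Icc_self hi⟩

/-- At a point of cell `i`, all earlier ramps are saturated at one and all later ones are still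
zero, so the increments telescope up to the left node of the cell. The induction splits off the
first cell and shifts `F`. -/
theorem sum_telescope_cutoff {N : ℕ} (F : Fin (N + 1) → ℝ) (i : Fin N) (θ : ℝ) :
    F 0 + ∑ j : Fin N, (F j.succ - F j.castSucc) * (if j < i then 1 else if j = i then θ else 0)
      = F i.castSucc + (F i.succ - F i.castSucc) * θ := by
  induction N with
  | zero => exact i.elim0
  | succ N ih =>
    rw [Fin.sum_univ_succ]
    induction i using Fin.cases with
    | zero => simp
    | succ i =>
      have := ih (fun j => F j.succ) i
      simp only [Fin.succ_lt_succ_iff, Fin.succ_inj, Fin.castSucc_zero, ← Fin.succ_castSucc,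
        Fin.succ_pos, if_true] at this ⊢
      rw [← this]
      ring

/-- On a cell, the nodal interpolant is a convex combination of the nodal values. -/
theorem interp1_eq (f : ℝ → ℝ) (i : Fin P.N) {t : ℝ}
    (ht : t ∈ Icc (P.x i.castSucc) (P.x i.succ)) :
    P.interp1 f t = f (P.x i.castSucc) + (f (P.x i.succ) - f (P.x i.castSucc)) *
      ((t - P.x i.castSucc) / (P.x i.succ - P.x i.castSucc)) := by
  have h := sum_telescope_cutoff (fun j => f (P.x j)) i
    ((t - P.x i.castSucc) / (P.x i.succ - P.x i.castSucc))
  rw [← h, interp1]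
  congr 1
  refine Finset.sum_congr rfl fun j _ => ?_
  congr 1
  have hj := P.cell_pos j
  split_ifs with h1 h2
  · have : P.x j.succ ≤ P.x i.castSucc := P.strictMono.monotone (Fin.succ_le_castSucc_iff.2 h1)
    have h3 : 1 ≤ (t - P.x j.castSucc) / (P.x j.succ - P.x j.castSucc) := by
      rw [one_le_div hj]; linarith [ht.1]
    rw [min_eq_left h3, max_eq_right zero_le_one]
  · subst h2
    rw [min_eq_right, max_eq_right]
    · exact div_nonneg (sub_nonneg.2 ht.1) hj.le
    · rw [div_le_one hj]; linarith [ht.2]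
  · have hij : i < j := lt_of_le_of_ne (not_lt.1 h1) (Ne.symm h2)
    have : P.x i.succ ≤ P.x j.castSucc := P.strictMono.monotone (Fin.succ_le_castSucc_iff.2 hij)
    refine max_eq_left ((min_le_right _ _).trans (div_nonpos_of_nonpos_of_nonneg ?_ hj.le))
    linarith [ht.2]

theorem le_interp1 (f : ℝ → ℝ) (i : Fin P.N) {t c : ℝ}
    (ht : t ∈ Icc (P.x i.castSucc) (P.x i.succ)) (h1 : c ≤ f (P.x i.castSucc))
    (h2 : c ≤ f (P.x i.succ)) : c ≤ P.interp1 f t := by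
  have hi := P.cell_pos i
  rw [P.interp1_eq f i ht]
  have h3 : 0 ≤ (t - P.x i.castSucc) / (P.x i.succ - P.x i.castSucc) :=
    div_nonneg (sub_nonneg.2 ht.1) hi.le
  have h4 : (t - P.x i.castSucc) / (P.x i.succ - P.x i.castSucc) ≤ 1 := by
    rw [div_le_one hi]; linarith [ht.2]
  nlinarith

theorem continuous_interp1 (f : ℝ → ℝ) : Continuous (P.interp1 f) := by
  unfold interp1
  fun_prop

theorem integrable_interp1 (f : ℝ → ℝ) : Integrable (P.interp1 f) (μI a b) :=
  ((P.continuous_interp1 f).continuousOn.integrableOn_Icc (a := a) (b := b)).mono_set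
    Ioo_subset_Icc_self

theorem interp1_nonneg (hab : a < b) {f : ℝ → ℝ} (hf : ∀ x, 0 ≤ f x) {t : ℝ}
    (ht : t ∈ Icc a b) : 0 ≤ P.interp1 f t := by
  obtain ⟨i, hi⟩ := P.exists_cell hab ht
  exact P.le_interp1 f i hi (hf _) (hf _)

theorem interp1_eq_zero {f : ℝ → ℝ} (hf : ∀ i, f (P.x i) = 0) (t : ℝ) : P.interp1 f t = 0 := by
  simp [interp1, hf]

end IntervalPartition

/-! ### The confining potential -/

section Potential

variable {R : ℕ} (G : Fin R → Matrix (Fin 3) (Fin 3) ℝ)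

theorem potential_nonneg (y : Vec3) : 0 ≤ potential G y :=
  Finset.sum_nonneg fun _ _ => by positivity

theorem continuous_potential : Continuous (potential G) := by
  unfold potential seminormG dotProduct Matrix.mulVec dotProduct
  fun_prop

theorem potential_eq_zero_iff {y : Vec3} : potential G y = 0 ↔ y ∈ confinement G := by
  unfold potential confinement
  rw [Finset.sum_eq_zero_iff_of_nonneg fun _ _ => by positivity]
  simp only [Finset.mem_univ, true_implies, mem_ofPred_eq]
  refine forall_congr' fun r => ?_
  have : (1 / 2 * (max (seminormG (G r) y - 1) 0) ^ 2 = 0) ↔ seminormG (G r) y ≤ 1 := by simp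
  -- `Real.sqrt` is zero on negative numbers, so `√q ≤ 1` and `q ≤ 1` are equivalent for every real
  -- `q`.
  rw [this, seminormG, Real.sqrt_le_one]

end Potential

/-! ### The liminf inequality -/

/-- Both summands are nonnegative, so each is bounded by `c` separately; clearing the factor `1 / (2
* ε)` makes the penalty integral of order `ε`. -/
theorem le_of_discreteEnergy_le (hab : a < b) {R m : ℕ} {κ : ℝ} (hκ : 0 < κ)
    {G : Fin R → Matrix (Fin 3) (Fin 3) ℝ} {L : H2 a b →L[ℝ] EuclideanSpace ℝ (Fin m)}
    {ℓ : EuclideanSpace ℝ (Fin m)} {P : IntervalPartition a b} {ε : ℝ} (hε : 0 < ε) {v : H2 a b}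
    {c : ℝ} (h : discreteEnergy κ G L ℓ P ε v ≤ (c : EReal)) :
    v ∈ discreteAdmissible P L ℓ ∧ κ / 2 * ‖der2 v‖ ^ 2 ≤ c ∧
      ∫ x in Ioo a b, P.interp1 (fun y => potential G (val v y)) x ≤ 2 * ε * c := by
  unfold discreteEnergy at h
  split_ifs at h with hv
  · rw [EReal.coe_le_coe_iff, integral_norm_sq_Lp] at h
    have h0 : 0 ≤ ∫ x in Ioo a b, P.interp1 (fun y => potential G (val v y)) x :=
      setIntegral_nonneg measurableSet_Ioo fun x hx =>
        P.interp1_nonneg hab (fun y => potential_nonneg G _) (Ioo_subset_Icc_self hx)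
    have h1 : 0 ≤ 1 / (2 * ε) * ∫ x in Ioo a b, P.interp1 (fun y => potential G (val v y)) x := by
      positivity
    have h2 : 0 ≤ κ / 2 * ‖der2 v‖ ^ 2 := by positivity
    refine ⟨hv, by linarith, ?_⟩
    have h3 : 1 / (2 * ε) * ∫ x in Ioo a b, P.interp1 (fun y => potential G (val v y)) x ≤ c := by
      linarith
    rw [one_div, inv_mul_le_iff₀ (by positivity)] at h3
    exact h3
  · exact absurd h (by simp)

theorem norm_val_sub_val_le (hab : a < b) (u : H2 a b) {K : ℝ}
    (hK : ∀ x ∈ Icc a b, ‖der u x‖ ≤ K) {x y : ℝ} (hx : x ∈ Icc a b) (hy : y ∈ Icc a b) :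
    ‖val u y - val u x‖ ≤ K * |y - x| := by
  rw [val_sub_val hab u hx hy]
  exact intervalIntegral.norm_integral_le_of_norm_le_const fun t ht =>
    hK t (uIcc_subset_Icc hx hy (uIoc_subset_uIcc ht))

theorem norm_der_node {m : ℕ} {L : H2 a b →L[ℝ] EuclideanSpace ℝ (Fin m)}
    {ℓ : EuclideanSpace ℝ (Fin m)} {P : IntervalPartition a b} {v : H2 a b}
    (hv : v ∈ discreteAdmissible P L ℓ) (i : Fin (P.N + 1)) : ‖der v (P.x i)‖ = 1 := by
  exact (pow_eq_one_iff_of_nonneg (norm_nonneg _) two_ne_zero).1 (hv.2.1 i)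

/-- Weak limits of sequences with bounded discrete energy are admissible and obey the energy
bound. -/
theorem admissible_of_discreteEnergy_le (hab : a < b) {R m : ℕ} {κ : ℝ} (hκ : 0 < κ)
    {G : Fin R → Matrix (Fin 3) (Fin 3) ℝ} {L : H2 a b →L[ℝ] EuclideanSpace ℝ (Fin m)}
    {ℓ : EuclideanSpace ℝ (Fin m)} {ι : Type*} {l : Filter ι} [l.NeBot]
    {P : ι → IntervalPartition a b} {ε : ι → ℝ} {u : ι → H2 a b} {v : H2 a b}
    (hP : Tendsto (fun i => (P i).mesh) l (𝓝 0)) (hε : Tendsto ε l (𝓝[>] 0))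
    (hu : Tendsto (fun i => toWeakSpace ℝ (H2 a b) (u i)) l (𝓝 (toWeakSpace ℝ (H2 a b) v)))
    {c : ℝ} (hE : ∀ᶠ i in l, discreteEnergy κ G L ℓ (P i) (ε i) (u i) ≤ (c : EReal)) :
    v ∈ admissibleConfined G L ℓ ∧ κ / 2 * ‖der2 v‖ ^ 2 ≤ c := by
  have hε0 : ∀ᶠ i in l, 0 < ε i := hε.eventually self_mem_nhdsWithin
  have hε' : Tendsto ε l (𝓝 0) := hε.mono_right nhdsWithin_le_nhds
  have hall : ∀ᶠ i in l, u i ∈ discreteAdmissible (P i) L ℓ ∧ κ / 2 * ‖der2 (u i)‖ ^ 2 ≤ c ∧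
      ∫ x in Ioo a b, (P i).interp1 (fun y => potential G (val (u i) y)) x ≤ 2 * ε i * c := by
    filter_upwards [hE, hε0] with i h1 h2 using le_of_discreteEnergy_le hab hκ h2 h1
  set M : ℝ := Real.sqrt (2 * c / κ) with hM
  have hM0 : 0 ≤ M := Real.sqrt_nonneg _
  have hbd : ∀ᶠ i in l, ‖der2 (u i)‖ ≤ M := by
    filter_upwards [hall] with i hi
    refine Real.le_sqrt_of_sq_le ?_
    rw [le_div_iff₀ hκ]
    linarith [hi.2.1]
  have hder : ∀ x ∈ Icc a b, Tendsto (fun i => der (u i) x) l (𝓝 (der v x)) := fun x hx =>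
    tendsto_of_weak_euclidean hu (evalCLM hab (1 : Fin 2) hx)
  have hval : ∀ x ∈ Icc a b, Tendsto (fun i => val (u i) x) l (𝓝 (val v x)) := fun x hx =>
    tendsto_of_weak_euclidean hu (evalCLM hab (0 : Fin 2) hx)
  have hunit : ∀ x ∈ Icc a b, ‖der v x‖ = 1 := by
    intro x hx
    have h1 : Tendsto (fun i => ‖der (u i) x‖ - 1) l (𝓝 (‖der v x‖ - 1)) :=
      (hder x hx).norm.sub_const 1
    have h2 : Tendsto (fun i => Real.sqrt (P i).mesh * M) l (𝓝 0) := by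
      have := ((Real.continuous_sqrt.tendsto 0).comp hP).mul_const M
      simpa using this
    -- Compare `x` with the left node of its cell, where the speed is one: the Hölder bound leaves
    -- an error of at most `√h * M`.
    have h3 : Tendsto (fun i => ‖der (u i) x‖ - 1) l (𝓝 0) := by
      refine squeeze_zero_norm' ?_ h2
      filter_upwards [hall, hbd] with i hi hbi
      obtain ⟨j, hj⟩ := (P i).exists_cell hab hx
      have h4 := norm_rep_sub_rep_le hab (u i) 1 ((P i).node_mem j.castSucc) hx
      rw [← norm_der_node hi.1 j.castSucc]
      refine (abs_norm_sub_norm_le _ _).trans (h4.trans ?_)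
      gcongr
      · rw [abs_of_nonneg (sub_nonneg.2 hj.1)]
        linarith [(P i).cell_le_mesh j, hj.2]
      · exact hbi
    linarith [tendsto_nhds_unique h1 h3]
  refine ⟨⟨?_, ?_, ?_⟩, ?_⟩
  · have h1 : (v.1 1 : ℝ → Vec3) =ᵐ[μI a b] der v := ae_eq_rep v 1
    filter_upwards [h1, ae_restrict_mem measurableSet_Ioo] with x hx hxI
    rw [hx]
    exact hunit x (Ioo_subset_Icc_self hxI)
  · refine tendsto_nhds_unique (tendsto_of_weak_euclidean hu L) ?_
    exact tendsto_const_nhds.congr' (hall.mono fun i hi => hi.1.2.2.symm)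
  · intro x hx
    rw [← potential_eq_zero_iff]
    by_contra hne
    have hp : 0 < potential G (val v x) := lt_of_le_of_ne (potential_nonneg G _) (Ne.symm hne)
    set p := potential G (val v x) with hpdef
    obtain ⟨r, hr, hball⟩ := Metric.eventually_nhds_iff.1
      ((continuous_potential G).continuousAt.eventually (lt_mem_nhds (half_lt_self hp)))
    -- A common Lipschitz constant: `a` is a node, so the speed there is one, and the Hölder bound
    -- adds at most `√(b - a) * M`.
    set K : ℝ := 1 + Real.sqrt (b - a) * M with hK
    have hK0 : 0 < K := by positivity
    have hKb : ∀ᶠ i in l, ∀ y ∈ Icc a b, ‖der (u i) y‖ ≤ K := by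
      filter_upwards [hall, hbd] with i hi hbi y hy
      have ha : a ∈ Icc a b := left_mem_Icc.2 hab.le
      have h1 := norm_rep_sub_rep_le hab (u i) 1 ha hy
      have h2 := norm_der_node hi.1 0
      rw [(P i).first] at h2
      have h3 : Real.sqrt |y - a| * ‖der2 (u i)‖ ≤ Real.sqrt (b - a) * M := by
        rw [abs_of_nonneg (sub_nonneg.2 hy.1)]
        gcongr
        exact hy.2
      have h4 := norm_le_norm_add_norm_sub' (der (u i) y) (der (u i) a)
      have h5 : ‖der (u i) y - der (u i) a‖ ≤ Real.sqrt |y - a| * ‖der2 (u i)‖ := h1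
      linarith
    -- Of the radius `r`, one half pays for `val (u i) x` not yet being at its limit, the other for
    -- moving a distance below `δ` at speed at most `K`.
    set δ : ℝ := r / (2 * K) with hδ
    have hδ0 : 0 < δ := by positivity
    -- Points of `(s, t)` are within `δ / 2` of `x`, and the mesh is eventually below `δ / 2`, so
    -- both nodes of their cells are within `δ` of `x`. The truncation keeps the interval in `[a,
    -- b]` with positive length even if `x` is an endpoint.
    set s : ℝ := max a (x - δ / 2) with hs
    set t : ℝ := min b (x + δ / 2) with ht
    have hst : s < t := by
      refine max_lt (lt_min hab ?_) (lt_min ?_ ?_) <;> linarith [hx.1, hx.2]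
    have hfin : ∀ᶠ i in l, (t - s) * (p / 2) ≤ 2 * ε i * c := by
      have hxr : ∀ᶠ i in l, dist (val (u i) x) (val v x) < r / 2 :=
        (hval x hx).eventually (Metric.ball_mem_nhds _ (half_pos hr))
      have hPδ : ∀ᶠ i in l, (P i).mesh < δ / 2 := hP.eventually (gt_mem_nhds (half_pos hδ0))
      filter_upwards [hall, hKb, hxr, hPδ] with i hi hKi hxi hPi
      have hnear : ∀ y ∈ Icc a b, |y - x| < δ → p / 2 ≤ potential G (val (u i) y) := by
        intro y hy hyx
        refine (hball ?_).le
        have h1 : dist (val (u i) y) (val (u i) x) ≤ K * |y - x| := by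
          rw [dist_eq_norm]; exact norm_val_sub_val_le hab (u i) hKi hx hy
        have h2 : K * |y - x| < r / 2 := by
          calc K * |y - x| < K * δ := by gcongr
            _ = r / 2 := by rw [hδ]; field_simp
        linarith [dist_triangle (val (u i) y) (val (u i) x) (val v x)]
      have hlow : ∀ y ∈ Ioo s t,
          p / 2 ≤ (P i).interp1 (fun y => potential G (val (u i) y)) y := by
        intro y hy
        have hy1 : a < y := (le_max_left _ _).trans_lt hy.1
        have hy2 : x - δ / 2 < y := (le_max_right _ _).trans_lt hy.1
        have hy3 : y < b := hy.2.trans_le (min_le_left _ _)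
        have hy4 : y < x + δ / 2 := hy.2.trans_le (min_le_right _ _)
        obtain ⟨j, hj⟩ := (P i).exists_cell hab ⟨hy1.le, hy3.le⟩
        have hmesh := (P i).cell_le_mesh j
        refine (P i).le_interp1 _ j hj (hnear _ ((P i).node_mem _) ?_)
          (hnear _ ((P i).node_mem _) ?_) <;>
        · rw [abs_lt]; constructor <;> linarith [hj.1, hj.2]
      have hint := (P i).integrable_interp1 (fun y => potential G (val (u i) y))
      have hsub : Ioo s t ⊆ Ioo a b := Ioo_subset_Ioo (le_max_left _ _) (min_le_left _ _)
      calc (t - s) * (p / 2) = ∫ _ in Ioo s t, p / 2 := by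
            simp [hst.le]
        _ ≤ ∫ y in Ioo s t, (P i).interp1 (fun y => potential G (val (u i) y)) y :=
            setIntegral_mono_on (by simp) (hint.mono_measure (Measure.restrict_mono hsub le_rfl))
              measurableSet_Ioo hlow
        _ ≤ ∫ y in Ioo a b, (P i).interp1 (fun y => potential G (val (u i) y)) y := by
            refine setIntegral_mono_set hint ?_ hsub.eventuallyLE
            filter_upwards [ae_restrict_mem measurableSet_Ioo] with y hy
            exact (P i).interp1_nonneg hab (fun y => potential_nonneg G _) (Ioo_subset_Icc_self hy)
        _ ≤ 2 * ε i * c := hi.2.2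
    have hlim : Tendsto (fun i => 2 * ε i * c) l (𝓝 0) := by
      have := (hε'.const_mul 2).mul_const c
      simpa using this
    have := ge_of_tendsto hlim hfin
    have : 0 < (t - s) * (p / 2) := mul_pos (sub_pos.2 hst) (half_pos hp)
    linarith
  · have h1 := tendsto_of_weak hu ((innerSL ℝ (der2 v)).comp (der2CLM a b))
    have h2 : Tendsto (fun i => inner ℝ (der2 v) (der2 (u i))) l
        (𝓝 (inner ℝ (der2 v) (der2 v))) := h1
    rw [real_inner_self_eq_norm_sq] at h2
    -- Young's inequality `⟨f, g⟩ ≤ (‖f‖² + ‖g‖²) / 2` passes to the limit, and half of `‖der2 v‖ ^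
    -- 2` is then absorbed.
    have h3 : ‖der2 v‖ ^ 2 ≤ (‖der2 v‖ ^ 2 + 2 * c / κ) / 2 := by
      refine le_of_tendsto h2 ?_
      filter_upwards [hall] with i hi
      have h4 : ‖der2 (u i)‖ ^ 2 ≤ 2 * c / κ := by
        rw [le_div_iff₀ hκ]; linarith [hi.2.1]
      have h5 := real_inner_le_norm (der2 v) (der2 (u i))
      nlinarith [sq_nonneg (‖der2 v‖ - ‖der2 (u i)‖)]
    have h6 : ‖der2 v‖ ^ 2 ≤ 2 * c / κ := by linarith
    rw [le_div_iff₀ hκ] at h6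
    linarith

/-- The liminf inequality. -/
theorem bendEnergy_le_liminf (hab : a < b) {R m : ℕ} {κ : ℝ} (hκ : 0 < κ)
    {G : Fin R → Matrix (Fin 3) (Fin 3) ℝ} {L : H2 a b →L[ℝ] EuclideanSpace ℝ (Fin m)}
    {ℓ : EuclideanSpace ℝ (Fin m)} {ι : Type*} {l : Filter ι}
    {P : ι → IntervalPartition a b} {ε : ι → ℝ} {u : ι → H2 a b} {v : H2 a b}
    (hP : Tendsto (fun i => (P i).mesh) l (𝓝 0)) (hε : Tendsto ε l (𝓝[>] 0))
    (hu : Tendsto (fun i => toWeakSpace ℝ (H2 a b) (u i)) l (𝓝 (toWeakSpace ℝ (H2 a b) v))) :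
    bendEnergy κ G L ℓ v ≤ liminf (fun i => discreteEnergy κ G L ℓ (P i) (ε i) (u i)) l ∧
      (liminf (fun i => discreteEnergy κ G L ℓ (P i) (ε i) (u i)) l < ⊤ →
        v ∈ admissibleConfined G L ℓ) := by
  have key : ∀ c : ℝ, liminf (fun i => discreteEnergy κ G L ℓ (P i) (ε i) (u i)) l < c →
      v ∈ admissibleConfined G L ℓ ∧ κ / 2 * ‖der2 v‖ ^ 2 ≤ c := by
    intro c hc
    -- An energy below `c` is only frequent, not eventual; intersecting `l` with that set plays the
    -- role of a subsequence. For the trivial filter the liminf is `⊤`, so `hc` already excludes it.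
    have hf : ∃ᶠ i in l, discreteEnergy κ G L ℓ (P i) (ε i) (u i) < c :=
      frequently_lt_of_liminf_lt (by isBoundedDefault) hc
    have : (l ⊓ 𝓟 {i | discreteEnergy κ G L ℓ (P i) (ε i) (u i) < c}).NeBot :=
      frequently_mem_iff_neBot.1 hf
    refine admissible_of_discreteEnergy_le hab hκ
      (l := l ⊓ 𝓟 {i | discreteEnergy κ G L ℓ (P i) (ε i) (u i) < c}) (hP.mono_left inf_le_left)
      (hε.mono_left inf_le_left) (hu.mono_left inf_le_left) ?_
    filter_upwards [mem_inf_of_right (mem_principal_self _)] with i hi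
    exact le_of_lt hi
  constructor
  · refine le_of_forall_gt fun c hc => ?_
    obtain ⟨c', hc1, hc2⟩ := EReal.lt_iff_exists_real_btwn.1 hc
    obtain ⟨h1, h2⟩ := key c' hc1
    rw [bendEnergy, if_pos h1, integral_norm_sq_Lp]
    exact (EReal.coe_le_coe_iff.2 h2).trans_lt hc2
  · intro hlt
    obtain ⟨c', hc1, _⟩ := EReal.lt_iff_exists_real_btwn.1 hlt
    exact (key c' hc1).1

/-! ### Cubic Hermite interpolation -/

/-- The quadratic coefficient of the cubic with values `p₀, p₁` and slopes `d₀, d₁` at the ends of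
an interval of length `h`. -/
def hermiteQuad (h : ℝ) (p₀ p₁ d₀ d₁ : Vec3) : Vec3 :=
  (3 / h ^ 2) • (p₁ - p₀) - (2 / h) • d₀ - (1 / h) • d₁

/-- The cubic coefficient of the cubic with values `p₀, p₁` and slopes `d₀, d₁` at the ends of an
interval of length `h`. -/
def hermiteCub (h : ℝ) (p₀ p₁ d₀ d₁ : Vec3) : Vec3 :=
  (1 / h ^ 2) • (d₀ + d₁) - (2 / h ^ 3) • (p₁ - p₀)

theorem hermite_value {h : ℝ} (hh : h ≠ 0) (p₀ p₁ d₀ d₁ : Vec3) :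
    p₀ + h • d₀ + h ^ 2 • hermiteQuad h p₀ p₁ d₀ d₁ + h ^ 3 • hermiteCub h p₀ p₁ d₀ d₁ = p₁ := by
  unfold hermiteQuad hermiteCub
  match_scalars <;> field_simp <;> ring

theorem hermite_slope {h : ℝ} (hh : h ≠ 0) (p₀ p₁ d₀ d₁ : Vec3) :
    d₀ + (2 * h) • hermiteQuad h p₀ p₁ d₀ d₁ + (3 * h ^ 2) • hermiteCub h p₀ p₁ d₀ d₁ = d₁ := by
  unfold hermiteQuad hermiteCub
  match_scalars <;> field_simp <;> ring

/-- The second derivative of the Hermite cubic differs little from `c` if the data are close to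
those of a parabola with second derivative `c`. -/
theorem norm_hermite_der2_sub_le {h τ ρ : ℝ} (hh : 0 < h) (hτ : τ ∈ Icc 0 h)
    {p₀ p₁ d₀ d₁ c : Vec3} (h1 : ‖d₁ - d₀ - h • c‖ ≤ ρ * h)
    (h2 : ‖p₁ - p₀ - h • d₀ - (h ^ 2 / 2) • c‖ ≤ ρ * h ^ 2) :
    ‖(2 : ℝ) • hermiteQuad h p₀ p₁ d₀ d₁ + (6 * τ) • hermiteCub h p₀ p₁ d₀ d₁ - c‖ ≤ 10 * ρ := by
  -- Exactness on parabolas: the error depends linearly on the two defects of the data alone. On the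
  -- cell their coefficients are at most `4 / h` and `6 / h ^ 2` in modulus, which gives `4 + 6 =
  -- 10`.
  have e : (2 : ℝ) • hermiteQuad h p₀ p₁ d₀ d₁ + (6 * τ) • hermiteCub h p₀ p₁ d₀ d₁ - c
      = ((6 * τ - 2 * h) / h ^ 2) • (d₁ - d₀ - h • c)
        + ((6 * h - 12 * τ) / h ^ 3) • (p₁ - p₀ - h • d₀ - (h ^ 2 / 2) • c) := by
    unfold hermiteQuad hermiteCub
    match_scalars <;> field_simp <;> ring
  rw [e]
  refine (norm_add_le _ _).trans ?_
  rw [norm_smul, norm_smul, Real.norm_eq_abs, Real.norm_eq_abs, abs_div, abs_div,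
    abs_of_pos (pow_pos hh 2), abs_of_pos (pow_pos hh 3)]
  have k1 : |6 * τ - 2 * h| ≤ 4 * h := by
    rw [abs_le]; constructor <;> linarith [hτ.1, hτ.2]
  have k2 : |6 * h - 12 * τ| ≤ 6 * h := by
    rw [abs_le]; constructor <;> linarith [hτ.1, hτ.2]
  calc |6 * τ - 2 * h| / h ^ 2 * ‖d₁ - d₀ - h • c‖
        + |6 * h - 12 * τ| / h ^ 3 * ‖p₁ - p₀ - h • d₀ - (h ^ 2 / 2) • c‖
      ≤ 4 * h / h ^ 2 * (ρ * h) + 6 * h / h ^ 3 * (ρ * h ^ 2) := by gcongr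
    _ = 10 * ρ := by field_simp; ring

theorem integral_linear (s y : ℝ) (A B : Vec3) :
    ∫ t in s..y, ((2 : ℝ) • A + (6 * (t - s)) • B) = (2 * (y - s)) • A + (3 * (y - s) ^ 2) • B := by
  have hd : ∀ t : ℝ, HasDerivAt (fun t => (2 * (t - s)) • A + (3 * (t - s) ^ 2) • B)
      ((2 : ℝ) • A + (6 * (t - s)) • B) t := by
    intro t
    have h0 : HasDerivAt (fun t => t - s) 1 t := (hasDerivAt_id t).sub_const s
    have h1 := (h0.const_mul 2).smul_const A
    have h2 := ((h0.pow 2).const_mul 3).smul_const B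
    refine (h1.add h2).congr_deriv ?_
    match_scalars <;> push_cast <;> ring
  rw [intervalIntegral.integral_eq_sub_of_hasDerivAt (fun t _ => hd t)
    (by apply Continuous.intervalIntegrable; fun_prop)]
  simp

theorem integral_quadratic (s y : ℝ) (d A B : Vec3) :
    ∫ t in s..y, (d + (2 * (t - s)) • A + (3 * (t - s) ^ 2) • B)
      = (y - s) • d + (y - s) ^ 2 • A + (y - s) ^ 3 • B := by
  have hd : ∀ t : ℝ, HasDerivAt (fun t => (t - s) • d + (t - s) ^ 2 • A + (t - s) ^ 3 • B)
      (d + (2 * (t - s)) • A + (3 * (t - s) ^ 2) • B) t := by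
    intro t
    have h0 : HasDerivAt (fun t => t - s) 1 t := (hasDerivAt_id t).sub_const s
    have h1 := (h0.pow 2).smul_const A
    have h2 := (h0.pow 3).smul_const B
    refine (((h0.smul_const d).add h1).add h2).congr_deriv ?_
    match_scalars <;> push_cast <;> ring
  rw [intervalIntegral.integral_eq_sub_of_hasDerivAt (fun t _ => hd t)
    (by apply Continuous.intervalIntegrable; fun_prop)]
  simp

namespace IntervalPartition

variable (P : IntervalPartition a b)

/-- The quadratic coefficient of the Hermite interpolant on a cell. -/
def quadCoeff (u : H2 a b) (i : Fin P.N) : Vec3 :=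
  hermiteQuad (P.x i.succ - P.x i.castSucc) (val u (P.x i.castSucc)) (val u (P.x i.succ))
    (der u (P.x i.castSucc)) (der u (P.x i.succ))

/-- The cubic coefficient of the Hermite interpolant on a cell. -/
def cubCoeff (u : H2 a b) (i : Fin P.N) : Vec3 :=
  hermiteCub (P.x i.succ - P.x i.castSucc) (val u (P.x i.castSucc)) (val u (P.x i.succ))
    (der u (P.x i.castSucc)) (der u (P.x i.succ))

/-- The second derivative of the Hermite interpolant. -/
def hermiteDer2 (u : H2 a b) (t : ℝ) : Vec3 :=
  ∑ i : Fin P.N, (Ioc (P.x i.castSucc) (P.x i.succ)).indicator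
    (fun t => (2 : ℝ) • P.quadCoeff u i + (6 * (t - P.x i.castSucc)) • P.cubCoeff u i) t

theorem memLp_hermiteDer2 (u : H2 a b) : MemLp (P.hermiteDer2 u) 2 (μI a b) := by
  unfold hermiteDer2
  refine memLp_finsetSum _ fun i _ => ?_
  refine MemLp.indicator measurableSet_Ioc (memLp_of_continuousOn (Continuous.continuousOn ?_))
  fun_prop

theorem hermiteDer2_eq (u : H2 a b) (i : Fin P.N) {t : ℝ}
    (ht : t ∈ Ioc (P.x i.castSucc) (P.x i.succ)) :
    P.hermiteDer2 u t
      = (2 : ℝ) • P.quadCoeff u i + (6 * (t - P.x i.castSucc)) • P.cubCoeff u i := by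
  unfold hermiteDer2
  -- Half-open cells are disjoint, so a single summand survives, also at the nodes.
  rw [Finset.sum_eq_single i, indicator_of_mem ht]
  · intro j _ hji
    refine indicator_of_notMem (fun hj => ?_) _
    rcases lt_or_gt_of_ne hji with h | h
    · have := P.strictMono.monotone (Fin.succ_le_castSucc_iff.2 h)
      linarith [ht.1, hj.2]
    · have := P.strictMono.monotone (Fin.succ_le_castSucc_iff.2 h)
      linarith [ht.2, hj.1]
  · simp

variable {P}

/-- Agreement at the left node is a hypothesis here, so that the formula can feed the induction over
the nodes in `eq_at_nodes`. -/
theorem der_eq_on_cell (hab : a < b) {u v : H2 a b} (hv : der2 v =ᵐ[μI a b] P.hermiteDer2 u)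
    {i : Fin P.N} (hi : der v (P.x i.castSucc) = der u (P.x i.castSucc)) {y : ℝ}
    (hy : y ∈ Icc (P.x i.castSucc) (P.x i.succ)) :
    der v y = der u (P.x i.castSucc) + (2 * (y - P.x i.castSucc)) • P.quadCoeff u i
      + (3 * (y - P.x i.castSucc) ^ 2) • P.cubCoeff u i := by
  have hym : y ∈ Icc a b := ⟨(P.node_mem _).1.trans hy.1, hy.2.trans (P.node_mem _).2⟩
  rw [der_eq_of_der2 hab hv (P.node_mem i.castSucc) hym, hi, add_assoc, ← integral_linear]
  congr 1
  refine intervalIntegral.integral_congr_ae (Eventually.of_forall fun t ht => ?_)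
  rw [uIoc_of_le hy.1] at ht
  exact P.hermiteDer2_eq u i ⟨ht.1, ht.2.trans hy.2⟩

theorem val_eq_on_cell (hab : a < b) {u v : H2 a b} (hv : der2 v =ᵐ[μI a b] P.hermiteDer2 u)
    {i : Fin P.N} (hi : der v (P.x i.castSucc) = der u (P.x i.castSucc))
    (hi' : val v (P.x i.castSucc) = val u (P.x i.castSucc)) {y : ℝ}
    (hy : y ∈ Icc (P.x i.castSucc) (P.x i.succ)) :
    val v y = val u (P.x i.castSucc) + ((y - P.x i.castSucc) • der u (P.x i.castSucc)
      + (y - P.x i.castSucc) ^ 2 • P.quadCoeff u i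
      + (y - P.x i.castSucc) ^ 3 • P.cubCoeff u i) := by
  have hym : y ∈ Icc a b := ⟨(P.node_mem _).1.trans hy.1, hy.2.trans (P.node_mem _).2⟩
  rw [← integral_quadratic, ← sub_eq_iff_eq_add', ← hi',
    val_sub_val hab v (P.node_mem i.castSucc) hym]
  refine intervalIntegral.integral_congr fun t ht => ?_
  rw [uIcc_of_le hy.1] at ht
  exact der_eq_on_cell hab hv hi ⟨ht.1, ht.2.trans hy.2⟩

/-- Only the data at `a` are prescribed. Agreement propagates from node to node because
`hermite_value` and `hermite_slope` say that integrating over a cell ends with the right value and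
slope. -/
theorem eq_at_nodes (hab : a < b) {u v : H2 a b} (hv : der2 v =ᵐ[μI a b] P.hermiteDer2 u)
    (h0 : val v a = val u a) (h1 : der v a = der u a) (i : Fin (P.N + 1)) :
    val v (P.x i) = val u (P.x i) ∧ der v (P.x i) = der u (P.x i) := by
  induction i using Fin.induction with
  | zero => rw [P.first]; exact ⟨h0, h1⟩
  | succ i ih =>
    have hpos := P.cell_pos i
    have hmem : P.x i.succ ∈ Icc (P.x i.castSucc) (P.x i.succ) :=
      right_mem_Icc.2 (sub_pos.1 hpos).le
    constructor
    · rw [val_eq_on_cell hab hv ih.2 ih.1 hmem, ← add_assoc, ← add_assoc]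
      exact hermite_value hpos.ne' _ _ _ _
    · rw [der_eq_on_cell hab hv ih.2 hmem]
      exact hermite_slope hpos.ne' _ _ _ _

/-- A curve with the Hermite second derivative and the initial data of `u` is the Hermite
interpolant of `u`. -/
theorem isHermiteInterpolant (hab : a < b) {u v : H2 a b}
    (hv : der2 v =ᵐ[μI a b] P.hermiteDer2 u) (h0 : val v a = val u a) (h1 : der v a = der u a) :
    IsHermiteInterpolant P u v := by
  have hn := eq_at_nodes hab hv h0 h1
  refine ⟨⟨contDiffOn_val hab v, fun i j => ?_⟩, hn⟩
  let X' : Polynomial ℝ := Polynomial.X - Polynomial.C (P.x i.castSucc)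
  refine ⟨Polynomial.C (val u (P.x i.castSucc) j) + (X' * Polynomial.C (der u (P.x i.castSucc) j)
    + X' ^ 2 * Polynomial.C (P.quadCoeff u i j) + X' ^ 3 * Polynomial.C (P.cubCoeff u i j)),
    ?_, fun t ht => ?_⟩
  · simp only [X']
    compute_degree
  · rw [val_eq_on_cell hab hv (hn _).2 (hn _).1 ht]
    simp [X']

/-- The second derivative of the Hermite interpolant is close to a continuous `u''`. -/
theorem norm_hermiteDer2_sub_le (hab : a < b) {u : H2 a b} {w : ℝ → Vec3}
    (hw : ContinuousOn w (Icc a b)) (huw : der2 u =ᵐ[μI a b] w) {ρ : ℝ}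
    (hρ : ∀ i : Fin P.N, ∀ t ∈ Icc (P.x i.castSucc) (P.x i.succ), ‖w t - w (P.x i.castSucc)‖ ≤ ρ)
    {t : ℝ} (ht : t ∈ Ioc a b) : ‖P.hermiteDer2 u t - w t‖ ≤ 11 * ρ := by
  obtain ⟨i, hi⟩ := P.exists_cell_Ioc ht
  have hpos := P.cell_pos i
  set s := P.x i.castSucc with hs
  set e := P.x i.succ with he
  have hsm : s ∈ Icc a b := P.node_mem _
  have hem : e ∈ Icc a b := P.node_mem _
  have hsub : Icc s e ⊆ Icc a b := Icc_subset_Icc hsm.1 hem.2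
  have hρ0 : 0 ≤ ρ := (norm_nonneg _).trans (hρ i t (Ioc_subset_Icc_self hi))
  have hwi : ∀ y ∈ Icc s e, IntervalIntegrable w volume s y := fun y hy =>
    (hw.mono ((Icc_subset_Icc_right hy.2).trans hsub)).intervalIntegrable_of_Icc hy.1
  -- On the cell `w` stays within `ρ` of `w s`. Integrating once and twice shows that the data of
  -- `u` are those of a parabola up to `ρ h` and `ρ h ^ 2`.
  have hder : ∀ y ∈ Icc s e, ‖der u y - der u s - (y - s) • w s‖ ≤ ρ * (y - s) := by
    intro y hy
    rw [der_eq_of_der2 hab huw hsm (hsub hy), add_sub_cancel_left,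
      ← intervalIntegral.integral_const, ← intervalIntegral.integral_sub (hwi y hy) (by simp)]
    refine (intervalIntegral.norm_integral_le_of_norm_le_const fun z hz => ?_).trans_eq
      (by rw [abs_of_nonneg (sub_nonneg.2 hy.1)])
    rw [uIoc_of_le hy.1] at hz
    exact hρ i z ⟨hz.1.le, hz.2.trans hy.2⟩
  have hdi : IntervalIntegrable (der u) volume s e :=
    ((continuousOn_rep u 1).mono hsub).intervalIntegrable_of_Icc (sub_pos.1 hpos).le
  have hval : ‖val u e - val u s - (e - s) • der u s - ((e - s) ^ 2 / 2) • w s‖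
      ≤ ρ * (e - s) ^ 2 := by
    have e1 : ∫ y in s..e, (y - s) • w s = ((e - s) ^ 2 / 2) • w s := by
      rw [intervalIntegral.integral_smul_const]
      congr 1
      simp [intervalIntegral.integral_sub]
      ring
    rw [val_sub_val hab u hsm hem, ← intervalIntegral.integral_const, ← e1,
      ← intervalIntegral.integral_sub hdi (by simp), ← intervalIntegral.integral_sub
        (hdi.sub (by simp)) (by apply Continuous.intervalIntegrable; fun_prop)]
    refine (intervalIntegral.norm_integral_le_of_norm_le_const (C := ρ * (e - s))
      fun z hz => ?_).trans_eq (by rw [abs_of_pos hpos]; ring)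
    rw [uIoc_of_le (sub_pos.1 hpos).le] at hz
    refine (hder z (Ioc_subset_Icc_self hz)).trans ?_
    gcongr
    exact hz.2
  have key := norm_hermite_der2_sub_le hpos (τ := t - s)
    ⟨sub_nonneg.2 hi.1.le, sub_le_sub_right hi.2 _⟩
    (hder e (right_mem_Icc.2 (sub_pos.1 hpos).le)) hval
  rw [P.hermiteDer2_eq u i hi]
  -- Replacing `w s` by `w t` costs one more `ρ`, hence 11.
  have h3 := hρ i t (Ioc_subset_Icc_self hi)
  have h4 := norm_sub_le_norm_sub_add_norm_sub ((2 : ℝ) • P.quadCoeff u i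
    + (6 * (t - s)) • P.cubCoeff u i) (w s) (w t)
  rw [norm_sub_rev (w s)] at h4
  have h5 : ‖(2 : ℝ) • P.quadCoeff u i + (6 * (t - s)) • P.cubCoeff u i - w s‖ ≤ 10 * ρ := key
  linarith

end IntervalPartition

/-! ### Convergence of the interpolants and recovery -/

/-- `MemH3` matches only the functions themselves. Uniqueness of weak derivatives, applied twice,
identifies the second derivatives, and in `H³` the second derivative has a continuous
representative. -/
theorem MemH3.exists_continuous_der2 {u : H2 a b} (hu : MemH3 u) :
    ∃ w : ℝ → Vec3, ContinuousOn w (Icc a b) ∧ der2 u =ᵐ[μI a b] w := by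
  obtain ⟨w, hw⟩ := hu
  have h0 : (u.1 0 : ℝ → Vec3) =ᵐ[μI a b] w.1 0 := by rw [hw]
  have h1 : (u.1 1 : ℝ → Vec3) =ᵐ[μI a b] w.1 1 :=
    IsWeakDeriv.ae_unique h0 (integrable_Lp _) (integrable_Lp _) (u.2 0) (w.2 0)
  have h2 : (u.1 2 : ℝ → Vec3) =ᵐ[μI a b] w.1 2 :=
    IsWeakDeriv.ae_unique h1 (integrable_Lp _) (integrable_Lp _) (u.2 1) (w.2 1)
  exact ⟨rep w 2, continuousOn_rep w 2, h2.trans (ae_eq_rep w 2)⟩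

/-- Poincaré's inequality for functions vanishing at the left end point. -/
theorem norm_apply_le_of_rep_eq_zero (hab : a < b) {k : ℕ} (u : Sobolev a b k) (i : Fin k)
    (h0 : rep u i a = 0) :
    ‖u.1 i.castSucc‖ ≤ (measureUnivNNReal (μI a b) : ℝ) ^ (2 : ENNReal).toReal⁻¹ *
      (Real.sqrt (b - a) * ‖u.1 i.succ‖) := by
  refine Lp.norm_le_of_ae_bound (by positivity) ?_
  filter_upwards [ae_eq_rep u i, ae_restrict_mem measurableSet_Ioo] with x hx hxI
  have h := norm_rep_sub_rep_le hab u i (left_mem_Icc.2 hab.le) (Ioo_subset_Icc_self hxI)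
  rw [h0, sub_zero, abs_of_pos (sub_pos.2 hxI.1)] at h
  rw [hx]
  refine h.trans ?_
  gcongr
  exact hxI.2.le

/-- Convergence in `H²` follows from convergence of the second derivatives if the initial data
agree. -/
theorem tendsto_H2_of_der2 (hab : a < b) {ι : Type*} {l : Filter ι} {U : ι → H2 a b} {u : H2 a b}
    (h0 : ∀ i, val (U i) a = val u a) (h1 : ∀ i, der (U i) a = der u a)
    (h2 : Tendsto (fun i => der2 (U i)) l (𝓝 (der2 u))) : Tendsto U l (𝓝 u) := by
  have ha : a ∈ Icc a b := left_mem_Icc.2 hab.le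
  set M : ℝ := (measureUnivNNReal (μI a b) : ℝ) ^ (2 : ENNReal).toReal⁻¹ with hM
  have hsub : ∀ i (j : Fin 2), rep (U i) j a = rep u j a → rep (U i - u) j a = 0 := by
    intro i j h
    have := (evalCLM hab j ha).map_sub (U i) u
    exact this.trans (sub_eq_zero.2 h)
  have d2 : Tendsto (fun i => ‖(U i).1 2 - u.1 2‖) l (𝓝 0) :=
    tendsto_iff_norm_sub_tendsto_zero.1 h2
  have hstep : ∀ f g : ι → ℝ, (∀ i, 0 ≤ f i) → (∀ i, f i ≤ M * (Real.sqrt (b - a) * g i)) →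
      Tendsto g l (𝓝 0) → Tendsto f l (𝓝 0) := by
    intro f g hf hfg hg
    refine squeeze_zero hf hfg ?_
    simpa using (hg.const_mul (Real.sqrt (b - a))).const_mul M
  have d1 : Tendsto (fun i => ‖(U i).1 1 - u.1 1‖) l (𝓝 0) :=
    hstep _ _ (fun _ => norm_nonneg _)
      (fun i => norm_apply_le_of_rep_eq_zero hab (U i - u) 1 (hsub i 1 (h1 i))) d2
  have d0 : Tendsto (fun i => ‖(U i).1 0 - u.1 0‖) l (𝓝 0) :=
    hstep _ _ (fun _ => norm_nonneg _)
      (fun i => norm_apply_le_of_rep_eq_zero hab (U i - u) 0 (hsub i 0 (h0 i))) d1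
  rw [tendsto_subtype_rng]
  have hpi : Tendsto (fun i => (U i).1.ofLp) l (𝓝 u.1.ofLp) := by
    refine tendsto_pi_nhds.2 fun j => tendsto_iff_norm_sub_tendsto_zero.2 ?_
    fin_cases j
    · exact d0
    · exact d1
    · exact d2
  exact ((PiLp.continuous_toLp 2 _).tendsto _).comp hpi

/-- The second derivatives of the Hermite interpolants converge if `u''` is continuous. -/
theorem tendsto_hermite_der2 (hab : a < b) {u : H2 a b} (hu : MemH3 u)
    {U : IntervalPartition a b → H2 a b}
    (hU : ∀ P : IntervalPartition a b, der2 (U P) =ᵐ[μI a b] P.hermiteDer2 u) :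
    Tendsto (fun P => der2 (U P)) (comap IntervalPartition.mesh (𝓝 0)) (𝓝 (der2 u)) := by
  obtain ⟨w, hw, huw⟩ := hu.exists_continuous_der2
  set M : ℝ := (measureUnivNNReal (μI a b) : ℝ) ^ (2 : ENNReal).toReal⁻¹ with hM
  have hM0 : 0 ≤ M := by positivity
  rw [Metric.tendsto_nhds]
  intro η hη
  -- `M` is the factor from a supremum bound to the `L²` norm. The choice yields the error `η * (M /
  -- (M + 1))`, which is below `η`.
  set ρ : ℝ := η / (11 * (M + 1)) with hρ
  have hρ0 : 0 < ρ := by positivity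
  obtain ⟨δ, hδ, hunif⟩ := Metric.uniformContinuousOn_iff.1
    (isCompact_Icc.uniformContinuousOn_of_continuous hw) ρ hρ0
  -- A neighbourhood in the `comap` filter constrains nothing but the mesh, so the limit is uniform
  -- over all partitions of small mesh.
  have hmesh : ∀ᶠ P : IntervalPartition a b in comap IntervalPartition.mesh (𝓝 0), P.mesh < δ :=
    tendsto_comap.eventually (gt_mem_nhds hδ)
  filter_upwards [hmesh] with P hP
  have hosc : ∀ i : Fin P.N, ∀ t ∈ Icc (P.x i.castSucc) (P.x i.succ),
      ‖w t - w (P.x i.castSucc)‖ ≤ ρ := by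
    intro i t ht
    have htm : t ∈ Icc a b := ⟨(P.node_mem _).1.trans ht.1, ht.2.trans (P.node_mem _).2⟩
    have := hunif t htm _ (P.node_mem i.castSucc) (by
      rw [Real.dist_eq, abs_of_nonneg (sub_nonneg.2 ht.1)]
      linarith [P.cell_le_mesh i, ht.2])
    rw [dist_eq_norm] at this
    exact this.le
  have hb : ‖der2 (U P) - der2 u‖ ≤ M * (11 * ρ) := by
    refine Lp.norm_le_of_ae_bound (by positivity) ?_
    filter_upwards [Lp.coeFn_sub (der2 (U P)) (der2 u), hU P, huw,
      ae_restrict_mem measurableSet_Ioo] with x h1 h2 h3 hx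
    rw [h1, Pi.sub_apply, h2, h3]
    exact IntervalPartition.norm_hermiteDer2_sub_le hab hw huw hosc (Ioo_subset_Ioc_self hx)
  rw [dist_eq_norm]
  refine hb.trans_lt ?_
  rw [hρ]
  have : M * (11 * (η / (11 * (M + 1)))) = η * (M / (M + 1)) := by field_simp
  rw [this]
  have : M / (M + 1) < 1 := by rw [div_lt_one (by positivity)]; linarith
  nlinarith

/-- Unit speed holds a.e. by definition; continuity of `der u` extends it to every point, in
particular to the nodes. -/
theorem norm_der_of_admissible (hab : a < b) {R m : ℕ} {G : Fin R → Matrix (Fin 3) (Fin 3) ℝ}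
    {L : H2 a b →L[ℝ] EuclideanSpace ℝ (Fin m)} {ℓ : EuclideanSpace ℝ (Fin m)} {u : H2 a b}
    (hu : u ∈ admissibleConfined G L ℓ) {x : ℝ} (hx : x ∈ Icc a b) : ‖der u x‖ = 1 := by
  have h1 : (u.1 1 : ℝ → Vec3) =ᵐ[μI a b] der u := ae_eq_rep u 1
  refine Measure.eqOn_Icc_of_ae_eq volume hab.ne (f := fun x => ‖der u x‖) (g := fun _ => (1 : ℝ))
    ?_ (continuousOn_rep u 1).norm continuousOn_const hx
  rw [← Measure.restrict_congr_set (μ := volume) Ioo_ae_eq_Icc]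
  filter_upwards [h1, hu.1] with y hy1 hy2
  rw [← hy1, hy2]

/-- Recovery by cubic Hermite interpolation. -/
theorem exists_hermite_recovery (hab : a < b) (κ : ℝ) {R m : ℕ}
    {G : Fin R → Matrix (Fin 3) (Fin 3) ℝ} {L : H2 a b →L[ℝ] EuclideanSpace ℝ (Fin m)}
    {ℓ : EuclideanSpace ℝ (Fin m)} (hL : IsBoundaryOperator L) {u : H2 a b}
    (hu : u ∈ admissibleConfined G L ℓ) (hu3 : MemH3 u) :
    ∃ U : IntervalPartition a b → H2 a b,
      (∀ P, IsHermiteInterpolant P u (U P) ∧ U P ∈ discreteAdmissible P L ℓ ∧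
        ∀ i, val (U P) (P.x i) ∈ confinement G) ∧
      Tendsto U (comap IntervalPartition.mesh (𝓝 0)) (𝓝 u) ∧
      Tendsto (fun p : IntervalPartition a b × ℝ => discreteEnergy κ G L ℓ p.1 p.2 (U p.1))
        (comap IntervalPartition.mesh (𝓝 0) ×ˢ 𝓝[>] 0) (𝓝 (bendEnergy κ G L ℓ u)) := by
  choose U hU2 hU0 hU1 using fun P : IntervalPartition a b =>
    exists_H2_of_der2 hab (val u a) (der u a) (P.memLp_hermiteDer2 u)
  have hH : ∀ P, IsHermiteInterpolant P u (U P) := fun P =>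
    IntervalPartition.isHermiteInterpolant hab (hU2 P) (hU0 P) (hU1 P)
  have hA : ∀ P, U P ∈ discreteAdmissible P L ℓ := by
    intro P
    refine ⟨(hH P).1, fun i => ?_, ?_⟩
    · rw [((hH P).2 i).2, norm_der_of_admissible hab hu (P.node_mem i), one_pow]
    · have hb := (hH P).2 (Fin.last _)
      rw [P.last] at hb
      rw [← hu.2.1]
      exact hL _ _ (hU0 P) (hU1 P) hb.1 hb.2
  have hD : ∀ P i, val (U P) (P.x i) ∈ confinement G := by
    intro P i
    rw [((hH P).2 i).1]
    exact hu.2.2 _ (P.node_mem i)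
  have hT := tendsto_hermite_der2 hab hu3 hU2
  refine ⟨U, fun P => ⟨hH P, hA P, hD P⟩, tendsto_H2_of_der2 hab hU0 hU1 hT, ?_⟩
  -- The nodal values lie in `D`, so the interpolated potential is identically zero and the energy
  -- does not depend on `ε`.
  have hE : ∀ p : IntervalPartition a b × ℝ, discreteEnergy κ G L ℓ p.1 p.2 (U p.1)
      = ((κ / 2 * ‖der2 (U p.1)‖ ^ 2 : ℝ) : EReal) := by
    intro p
    rw [discreteEnergy, if_pos (hA p.1), integral_norm_sq_Lp]
    simp only [p.1.interp1_eq_zero (f := fun y => potential G (val (U p.1) y))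
      fun i => (potential_eq_zero_iff G).2 (hD p.1 i)]
    simp
  simp only [hE]
  rw [bendEnergy, if_pos hu, integral_norm_sq_Lp]
  refine (continuous_coe_real_ereal.tendsto _).comp ?_
  exact ((hT.norm.pow 2).const_mul (κ / 2)).comp tendsto_fst

end ConfinedRod

end

theorem mainTheorem1
    (a b : ℝ) (hab : a < b) (κ : ℝ) (hκ : 0 < κ)
    (R : ℕ) (G : Fin R → Matrix (Fin 3) (Fin 3) ℝ) (hG : ∀ r, (G r).PosSemidef)
    (m : ℕ) (L : H2 a b →L[ℝ] EuclideanSpace ℝ (Fin m)) (ℓ : EuclideanSpace ℝ (Fin m)) :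
    -- (i) the liminf inequality
    (∀ (ι : Type*) (l : Filter ι) (P : ι → IntervalPartition a b) (ε : ι → ℝ) (u : ι → H2 a b) (v : H2 a b),
      Tendsto (fun i => (P i).mesh) l (𝓝 0) → Tendsto ε l (𝓝[>] 0) →
      Tendsto (fun i => toWeakSpace ℝ (H2 a b) (u i)) l (𝓝 (toWeakSpace ℝ (H2 a b) v)) →
      bendEnergy κ G L ℓ v ≤ liminf (fun i => discreteEnergy κ G L ℓ (P i) (ε i) (u i)) l ∧
      (liminf (fun i => discreteEnergy κ G L ℓ (P i) (ε i) (u i)) l < ⊤ →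
        v ∈ admissibleConfined G L ℓ)) ∧
    -- (ii) the recovery sequence
    (IsBoundaryOperator L → ∀ u ∈ admissibleConfined G L ℓ, MemH3 u →
      ∃ U : IntervalPartition a b → H2 a b,
        (∀ P, IsHermiteInterpolant P u (U P) ∧ U P ∈ discreteAdmissible P L ℓ ∧
          ∀ i, val (U P) (P.x i) ∈ confinement G) ∧
        Tendsto U (comap IntervalPartition.mesh (𝓝 0)) (𝓝 u) ∧
        Tendsto (fun p : IntervalPartition a b × ℝ => discreteEnergy κ G L ℓ p.1 p.2 (U p.1))
          (comap IntervalPartition.mesh (𝓝 0) ×ˢ 𝓝[>] 0) (𝓝 (bendEnergy κ G L ℓ u))) := by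
  exact ⟨fun _ _ _ _ _ _ hP hε hu => bendEnergy_le_liminf hab hκ hP hε hu,
    fun hL _ hu hu3 => exists_hermite_recovery hab κ hL hu hu3⟩
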